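/- **Setting.** Let $T>0$, $z_0\in\mathbb R^d$, with Euclidean scalar product $\langle\cdot,\cdot\rangle$ and norm $\|\cdot\|$. Let $A\in\mathbb R^{d\times d}$ be symmetric positive definite and let $\mathcal F\in C^2(\mathbb R^d;\mathbb R)$, $\mathcal F\ge 0$, satisfy $\|D^2\mathcal F(z)v\|\le C(1+\|z\|^q)\|v\|$ for all $z,v$, with some $C>0$, $q\ge1$. Let $\mathcal R:\mathbb R^d\to[0,\infty)$ be convex, lower semicontinuous, positively $1$-homogeneous, with $c\|z\|\le\mathcal R(z)\le C\|z\|$ for some $c,C>0$. Put $\mathcal E(z)=\frac12\langle Az,z\rangle+\mathcal F(z)$ and assume that $-D\mathcal E(z_0)+\ell_0\in\partial\mathcal R(0)$ for some $\ell_0\in\mathbb R^d$. Let $BV([a,b];\mathbb R^d)$ be the set of functions $[a,b]\to\mathbb R^d$ (defined pointwise) of finite total variation. Let $\ell\in BV([0,T];\mathbb R^d)$ and $\mathcal I(t,z)=\mathcal E(z)-\langle\ell(t),z\rangle$. **Local solutions.** $z\in BV([0,T];\mathbb R^d)$ is a *local solution* for $\ell$ if $0\in\partial\mathcal R(0)+D_z\mathcal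 I(t,z(t))$ for a.a. $t\in[0,T]$ and, for all $0\le t_1\le t_2\le T$, $$\mathcal I(t_2,z(t_2))+\mathrm{Diss}_{\mathcal R}(z;[t_1,t_2])\le\mathcal I(t_1,z(t_1))-\int_{t_1}^{t_2}z(r)\,d\ell(r),$$ where $\mathrm{Diss}_{\mathcal R}(z;[t_1,t_2])$ is the supremum of $\sum_i\mathcal R(z(\xi_i)-z(\xi_{i-1}))$ over all partitions $t_1=\xi_0<\dots<\xi_n=t_2$ and the integral is the Kurzweil(–Stieltjes) integral with respect to the scalar product. It is not required that $z(0)=z_0$. **Relaxed solutions.** For $\hat\ell\in BV([0,S];\mathbb R^d)$ and a continuous $\hat z$ let $e(s)=\mathrm{dist}\big(-A\hat z(s)-D\mathcal F(\hat z(s))+\hat\ell(s),\,\partial\mathcal R(0)\big)$. A tuple $(S,\hat t,\hat z,\hat\ell)\in(0,\infty)\times W^{1,\infty}(0,S)\times W^{1,\infty}(0,S;\mathbb R^d)\times BV([0,S];\mathbb R^d)$ (with the continuous representatives of $\hat t,\hat z$) is a *relaxed solution* for $\ell$ if * $\hat t(0)=0$, $\hat t(S)=T$, $\hat z(0)=z_0$;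 * for a.a. $s\in(0,S)$: $\hat t'(s)\ge0$, $\hat t'(s)\,e(s)=0$ and $\hat t'(s)+\mathcal R(\hat z'(s))+\|\hat z'(s)\|\,e(s)=1$; * for all $s_1,s_2\in[0,S]$: $\mathcal E(\hat z(s_2))+\int_{s_1}^{s_2}\big(\mathcal R(\hat z'(r))+\|\hat z'(r)\|e(r)\big)dr=\mathcal E(\hat z(s_1))+\int_{s_1}^{s_2}\langle\hat\ell(r),\hat z'(r)\rangle dr$; * $\hat\ell(s)=\ell(\hat t(s))$ for a.a. $s\in M$, where $M$ is the set of all $s\in(0,S)$ with $\hat t(s_1)<\hat t(s_2)$ whenever $s_1,s_2\in[0,S]$, $s_1<s<s_2$. Let $\mathfrak P(\hat t,\hat z)$ be the set of all $z:[0,T]\to\mathbb R^d$ such that for every $t\in[0,T]$ there is $s\in[0,S]$ with $(t,z(t))=(\hat t(s),\hat z(s))$. **Theorem 4.3.** Assume in addition that $\mathcal R$ is symmetric, i.e. $\mathcal R(z_1)=\mathcal R(z_2)\iff\|z_1\|=\|z_2\|$ for all $z_1,z_2\in\mathbb R^d$. Let $z\in BV([0,T];\mathbb R^d)$ be a local solution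 for $\ell\in BV([0,T];\mathbb R^d)$ which has only finitely many points of discontinuity in $[0,T]$. Then there are $S>0$, $\hat t$, $\hat z$ and $\hat\ell\in BV([0,S];\mathbb R^d)$ such that $(S,\hat t,\hat z,\hat\ell)$ is a relaxed solution for $\ell$ and $z\in\mathfrak P(\hat t,\hat z)$. Moreover, they can be chosen so that, in jumps, $\hat z$ is the linear interpolant and $\hat\ell=A\hat z+D\mathcal F(\hat z)+\hat z'/\|\hat z'\|^2$. Precisely, with the conventions $z(0-):=z_0$ and $z(T+):=z(T)$, for every $t\in[0,T]$ one has $\hat t^{-1}(t)=[a,c]$ with some $b\in[a,c]$ such that $b-a=\mathcal R(z(t)-z(t-))$ and $c-b=\mathcal R(z(t+)-z(t))$; on $[a,b]$, $\hat z$ is the linear interpolant from $z(t-)$ to $z(t)$, and on $[b,c]$ from $z(t)$ to $z(t+)$; and on $(a,b)\cup(b,c)$ one has $\hat z'\ne0$ and $$\hat\ell(s)=A\hat z(s)+D\mathcal F(\hat z(s))+\frac{\hat z'(s)}{\|\hat z'(s)\|^2}.$$ -/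

import Mathlib

open MeasureTheory Set

open scoped ENNReal ContDiff

noncomputable section

namespace RIS

/-- The space `ℝ^d` with the standard scalar product and the Euclidean norm. -/
abbrev Vec (d : ℕ) : Type := EuclideanSpace ℝ (Fin d)

/-- The matrix-vector product `A z` in `ℝ^d`. -/
def mulVec {d : ℕ} (A : Matrix (Fin d) (Fin d) ℝ) (z : Vec d) : Vec d :=
  Matrix.toEuclideanLin A z

/-- The time-independent part of the energy, `E(z) = 1/2 ⟨A z, z⟩ + F(z)`. -/
def storedEnergy {d : ℕ} (A : Matrix (Fin d) (Fin d) ℝ) (F : Vec d → ℝ) (z : Vec d) : ℝ :=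
  1 / 2 * inner ℝ (mulVec A z) z + F z

/-- The energy `I(t, z) = E(z) - ⟨ℓ(t), z⟩` for the load `ℓ`. -/
def energy {d : ℕ} (A : Matrix (Fin d) (Fin d) ℝ) (F : Vec d → ℝ) (l : ℝ → Vec d)
    (t : ℝ) (z : Vec d) : ℝ :=
  storedEnergy A F z - inner ℝ (l t) z

/-- The convex subdifferential `∂R(x)`. -/
def subdiff {d : ℕ} (R : Vec d → ℝ) (x : Vec d) : Set (Vec d) :=
  {xi | ∀ v, R x + inner ℝ xi (v - x) ≤ R v}

/-- The standing assumptions on the dissipation: it is convex, lower semicontinuous, positively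
1-homogeneous, and bounded from below and above by multiples of the norm. (It is real-valued,
hence proper.) -/
structure IsDissipation {d : ℕ} (R : Vec d → ℝ) : Prop where
  convex : ConvexOn ℝ univ R
  lsc : LowerSemicontinuous R
  homogeneous : ∀ (z : Vec d) (a : ℝ), 0 < a → R (a • z) = a * R z
  bounds : ∃ c C : ℝ, 0 < c ∧ 0 < C ∧ ∀ z, c * ‖z‖ ≤ R z ∧ R z ≤ C * ‖z‖

/-- The standing assumptions on the nonlinear part `F` of the energy: it is nonnegative and `C^2`,
and its second derivative grows at most polynomially. -/
structure IsNonlinearity {d : ℕ} (F : Vec d → ℝ) : Prop where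
  smooth : ContDiff ℝ 2 F
  nonneg : ∀ z, 0 ≤ F z
  growth : ∃ C q : ℝ, 0 < C ∧ 1 ≤ q ∧
    ∀ z v : Vec d, ‖fderiv ℝ (fderiv ℝ F) z v‖ ≤ C * (1 + ‖z‖ ^ q) * ‖v‖

/-- `g` is the weak derivative of `u` on the interval `(0, S)`. -/
def HasWeakDerivOn {V : Type*} [NormedAddCommGroup V] [NormedSpace ℝ V] (S : ℝ)
    (u g : ℝ → V) : Prop :=
  ∀ φ : ℝ → ℝ, ContDiff ℝ ∞ φ → HasCompactSupport φ → tsupport φ ⊆ Ioo 0 S →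
    ∫ s in Ioo 0 S, deriv φ s • u s = - ∫ s in Ioo 0 S, φ s • g s

/-- `u` belongs to `W^{1,∞}(0, S; V)` with weak derivative `g`. As usual, `u` stands for the
representative which is continuous on `[0, S]`. -/
structure IsW1Infty {V : Type*} [NormedAddCommGroup V] [NormedSpace ℝ V] (S : ℝ)
    (u g : ℝ → V) : Prop where
  continuousOn : ContinuousOn u (Icc 0 S)
  memLp : MemLp u ∞ (volume.restrict (Ioo 0 S))
  memLp_deriv : MemLp g ∞ (volume.restrict (Ioo 0 S))
  weakDeriv : HasWeakDerivOn S u g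

/-- `x` lists the nodes `a = x 0 < x 1 < ⋯ < x n = b` of a partition of `[a, b]`
(with `n = 0` exactly when `a = b`). -/
def IsPartition (a b : ℝ) (n : ℕ) (x : ℕ → ℝ) : Prop :=
  x 0 = a ∧ x n = b ∧ ∀ i < n, x i < x (i + 1)

/-- The `R`-dissipation `Diss_R(z; [a, b])` of a curve `z` over `[a, b]`. The supremum is that
of a bounded set whenever `z` has bounded variation and `R ≤ C ‖·‖`. -/
def diss {d : ℕ} (R : Vec d → ℝ) (z : ℝ → Vec d) (a b : ℝ) : ℝ :=
  sSup {v | ∃ (n : ℕ) (x : ℕ → ℝ), IsPartition a b n x ∧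
    v = ∑ i ∈ Finset.range n, R (z (x (i + 1)) - z (x i))}

/-- `J` is the Kurzweil(-Stieltjes) integral `∫_a^b f dg`: the sums `∑ ⟨f(τ_i), g(x_{i+1}) - g(x_i)⟩`
tend to `J` along the tagged partitions that are fine with respect to a gauge. -/
def HasKurzweilIntegral {d : ℕ} (f g : ℝ → Vec d) (a b J : ℝ) : Prop :=
  ∀ ε > 0, ∃ δ : ℝ → ℝ, (∀ t ∈ Icc a b, 0 < δ t) ∧
    ∀ (n : ℕ) (x τ : ℕ → ℝ), IsPartition a b n x →
      (∀ i < n, τ i ∈ Icc (x i) (x (i + 1)) ∧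
        Icc (x i) (x (i + 1)) ⊆ Ioo (τ i - δ (τ i)) (τ i + δ (τ i))) →
      |∑ i ∈ Finset.range n, inner ℝ (f (τ i)) (g (x (i + 1)) - g (x i)) - J| < ε

/-- Local solutions on `[0, T]` for the load `ℓ`: functions of bounded variation that are locally
stable at almost every time and satisfy the energy inequality between any two times. -/
structure IsLocalSolution {d : ℕ} (A : Matrix (Fin d) (Fin d) ℝ) (F R : Vec d → ℝ) (T : ℝ)
    (l z : ℝ → Vec d) : Prop where
  bv : BoundedVariationOn z (Icc 0 T)
  stable : ∀ᵐ t ∂(volume.restrict (Icc 0 T)),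
    ∃ xi ∈ subdiff R 0, 0 = xi + gradient (energy A F l t) (z t)
  energy_le : ∀ t₁ t₂, 0 ≤ t₁ → t₁ ≤ t₂ → t₂ ≤ T →
    ∃ J, HasKurzweilIntegral z l t₁ t₂ J ∧
      energy A F l t₂ (z t₂) + diss R z t₁ t₂ ≤ energy A F l t₁ (z t₁) - J

/-- The distance of the driving force `-D_z I(s, z(s))` to `∂R(0)`. -/
def forceDist {d : ℕ} (A : Matrix (Fin d) (Fin d) ℝ) (F R : Vec d → ℝ)
    (l z : ℝ → Vec d) (s : ℝ) : ℝ :=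
  Metric.infDist (-gradient (energy A F l s) (z s)) (subdiff R 0)

/-- The set of points of `(0, S)` at which `that` is increasing. -/
def increasingSet (S : ℝ) (that : ℝ → ℝ) : Set ℝ :=
  {s ∈ Ioo 0 S | ∀ s₁ ∈ Icc 0 S, ∀ s₂ ∈ Icc 0 S, s₁ < s → s < s₂ → that s₁ < that s₂}

/-- `(S, that, zhat, lhat)` is a relaxed (normalized, parametrized) solution for the load `ℓ`;
`dt` and `dz` are the weak derivatives of `that` and `zhat`. -/
structure IsRelaxedSolutionWith {d : ℕ} (A : Matrix (Fin d) (Fin d) ℝ) (F R : Vec d → ℝ)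
    (z₀ : Vec d) (T : ℝ) (l : ℝ → Vec d)
    (S : ℝ) (that : ℝ → ℝ) (zhat lhat : ℝ → Vec d) (dt : ℝ → ℝ) (dz : ℝ → Vec d) : Prop where
  pos : 0 < S
  w1_time : IsW1Infty S that dt
  w1_state : IsW1Infty S zhat dz
  bv_load : BoundedVariationOn lhat (Icc 0 S)
  time_zero : that 0 = 0
  time_end : that S = T
  state_zero : zhat 0 = z₀
  monotone : ∀ᵐ s ∂(volume.restrict (Ioo 0 S)), 0 ≤ dt s
  complementarity : ∀ᵐ s ∂(volume.restrict (Ioo 0 S)), dt s * forceDist A F R lhat zhat s = 0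
  normalization : ∀ᵐ s ∂(volume.restrict (Ioo 0 S)),
    dt s + R (dz s) + ‖dz s‖ * forceDist A F R lhat zhat s = 1
  energy_eq : ∀ s₁ ∈ Icc 0 S, ∀ s₂ ∈ Icc 0 S,
    storedEnergy A F (zhat s₂)
        + ∫ r in s₁..s₂, (R (dz r) + ‖dz r‖ * forceDist A F R lhat zhat r)
      = storedEnergy A F (zhat s₁) + ∫ r in s₁..s₂, inner ℝ (lhat r) (dz r)
  load_eq : ∀ᵐ s, s ∈ increasingSet S that → lhat s = l (that s)

/-- `(S, that, zhat, lhat)` is a relaxed solution for the load `ℓ`. -/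
def IsRelaxedSolution {d : ℕ} (A : Matrix (Fin d) (Fin d) ℝ) (F R : Vec d → ℝ)
    (z₀ : Vec d) (T : ℝ) (l : ℝ → Vec d)
    (S : ℝ) (that : ℝ → ℝ) (zhat lhat : ℝ → Vec d) : Prop :=
  ∃ (dt : ℝ → ℝ) (dz : ℝ → Vec d), IsRelaxedSolutionWith A F R z₀ T l S that zhat lhat dt dz

/-- The set of projections of `(that, zhat)`: the functions on `[0, T]` whose graph is contained in
the trajectory `s ↦ (that s, zhat s)`. -/
def projections {d : ℕ} (T S : ℝ) (that : ℝ → ℝ) (zhat : ℝ → Vec d) : Set (ℝ → Vec d) :=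
  {z | ∀ t ∈ Icc 0 T, ∃ s ∈ Icc 0 S, t = that s ∧ z t = zhat s}

/-- The left limit `z(t-)` for `0 < t ≤ T`, with `z(0-)` set to the prescribed initial state. -/
def leftState {d : ℕ} (z₀ : Vec d) (z : ℝ → Vec d) (t : ℝ) : Vec d :=
  if t ≤ 0 then z₀ else Function.leftLim z t

/-- The right limit `z(t+)` for `0 ≤ t < T`, with `z(T+)` set to `z(T)`. -/
def rightState {d : ℕ} (T : ℝ) (z : ℝ → Vec d) (t : ℝ) : Vec d :=
  if T ≤ t then z T else Function.rightLim z t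

/-- On `[a, b]` the curve `zhat` is the linear interpolant from `p` to `q`, the length of `[a, b]`
is the dissipation `R(q - p)`, and inside `(a, b)` the load `lhat` is
`A zhat + DF(zhat) + zhat' / ‖zhat'‖²`, where `zhat' ≠ 0`. -/
def IsLinearJump {d : ℕ} (A : Matrix (Fin d) (Fin d) ℝ) (F R : Vec d → ℝ)
    (zhat lhat : ℝ → Vec d) (a b : ℝ) (p q : Vec d) : Prop :=
  b - a = R (q - p) ∧ zhat a = p ∧ zhat b = q ∧
  (∀ s ∈ Icc a b, zhat s = p + ((s - a) / (b - a)) • (q - p)) ∧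
  ∀ s ∈ Ioo a b, DifferentiableAt ℝ zhat s ∧ deriv zhat s ≠ 0 ∧
    lhat s = mulVec A (zhat s) + gradient F (zhat s)
      + (1 / ‖deriv zhat s‖ ^ 2) • deriv zhat s

end RIS

end

/-!
Symmetry forces `R = ρ ‖·‖`, so that `∂R(0)` is the closed ball of radius `ρ`. The relaxed solution
is the completed graph of `z`, parametrized by `b(t) = t + ρ V(t)` with `V` the variation of `z`:
the jumps are filled in by segments run through with speed `1 / ρ`. To treat the conventions at `0`
and `T` like any other jump, `z` is first extended to the real line, by `z₀` for negative times and
by `z T` after `T` (`extendState`). The time component `graphTime` is the generalized inverse of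
`b`; it and the space component `graphState` are Lipschitz (`mul_dist_graphState_le`).

* Normalization. From `mul_dist_graphState_le` one gets `t̂' + ρ ‖ẑ'‖ ≤ 1` almost everywhere. Both
  sides have the same integral, because the length of the completed graph is at least the variation
  of `z`; hence equality holds almost everywhere (`ae_deriv_graphTime_add`).

* Stability. Inside a jump the load is chosen so that the driving force is `ρ² ẑ'`, of norm `ρ`.
  Off the jumps the parameter is in bijection with time, and local stability extends from almost
  every time to every continuity point of the load, that is, to all but countably many parameters.
  So the distance `e` vanishes almost everywhere (`ae_forceDist_eq_zero`), which gives both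
  complementarity and normalization.

* Energy balance. By the chain rule (`integral_inner_storedGrad`) it suffices that the rate
  `⟨∇E(ẑ), ẑ'⟩ + ρ ‖ẑ'‖ - ⟨ℓ̂, ẑ'⟩` vanishes almost everywhere. Inside a jump this is a computation.
  On a time interval without jumps the rate is nonnegative by stability, while its integral is
  nonpositive by the energy inequality: integration by parts turns the Kurzweil integral `∫ z dℓ`
  into `∫ ⟨ℓ̂, ẑ'⟩` (`HasKurzweilIntegral.eq_sub_integral`), and the dissipation is at least `ρ`
  times the variation (`mul_variationFrom_sub_le_diss`). Countably many such intervals cover all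
  parameters off the jumps (`ae_energy_rate_graphLoad`).

* The load has bounded variation because there are only finitely many jumps: between consecutive
  end points of segments it is either Lipschitz or the given load in a monotone reparametrization
  (`boundedVariationOn_graphLoad`).
-/

noncomputable section

namespace RIS

open Filter Topology Function
open scoped NNReal

/-! ### Functions of bounded variation -/

section Graph

variable {E : Type*} [NormedAddCommGroup E]

/-- A function whose increments are dominated by those of a bounded monotone function has bounded
variation. -/
theorem boundedVariationOn_of_dominated {f : ℝ → E} {φ : ℝ → ℝ} {s : Set ℝ} {C : ℝ}
    (hφ : MonotoneOn φ s) (hC : ∀ x ∈ s, |φ x| ≤ C)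
    (h : ∀ x ∈ s, ∀ y ∈ s, x ≤ y → dist (f x) (f y) ≤ φ y - φ x) : BoundedVariationOn f s := by
  refine ne_top_of_le_ne_top (hφ.boundedVariationOn hC) (iSup_mono fun p => ?_)
  refine Finset.sum_le_sum fun i _ => ?_
  have hi := h _ (p.2.2.2 i) _ (p.2.2.2 (i + 1)) (p.2.2.1 i.le_succ)
  rw [edist_dist, edist_dist, dist_comm, Real.dist_eq]
  exact ENNReal.ofReal_le_ofReal (hi.trans (le_abs_self _))

theorem boundedVariationOn_comp_monotone {f : ℝ → E} {s t : Set ℝ} {φ : ℝ → ℝ}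
    (hf : BoundedVariationOn f s) (hφ : MonotoneOn φ t) (hst : MapsTo φ t s) :
    BoundedVariationOn (f ∘ φ) t :=
  ne_top_of_le_ne_top hf (eVariationOn.comp_le_of_monotoneOn f φ hφ hst)

/-- The signed variation of `w` between the base point `-1` and `t`. The base point is negative
because the functions it is applied to are constant on `(-∞, 0)` and may jump at `0`. -/
def variationFrom (w : ℝ → E) (t : ℝ) : ℝ :=
  variationOnFromTo w univ (-1) t

variable {w : ℝ → E}

theorem variationFrom_sub (hw : BoundedVariationOn w univ) {x y : ℝ} (hxy : x ≤ y) :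
    variationFrom w y - variationFrom w x = (eVariationOn w (Icc x y)).toReal := by
  rw [variationFrom, variationFrom, variationOnFromTo.sub_right hw.locallyBoundedVariationOn
    (mem_univ _) (mem_univ _) (mem_univ _), variationOnFromTo.eq_of_le _ _ hxy, univ_inter]

theorem dist_le_variationFrom_sub (hw : BoundedVariationOn w univ) {x y : ℝ} (hxy : x ≤ y) :
    dist (w x) (w y) ≤ variationFrom w y - variationFrom w x := by
  rw [variationFrom_sub hw hxy, dist_edist]
  exact ENNReal.toReal_mono (hw.mono (subset_univ _))
    (eVariationOn.edist_le w (left_mem_Icc.2 hxy) (right_mem_Icc.2 hxy))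

theorem variationFrom_monotone (hw : BoundedVariationOn w univ) : Monotone (variationFrom w) :=
  fun x y hxy => by
    have := (dist_nonneg (x := w x) (y := w y)).trans (dist_le_variationFrom_sub hw hxy)
    linarith

theorem exists_abs_variationFrom_le (hw : BoundedVariationOn w univ) :
    ∃ C, ∀ t, |variationFrom w t| ≤ C :=
  ⟨_, fun _ => variationOnFromTo.abs_le_eVariationOn hw⟩

theorem countable_not_continuousAt (hw : BoundedVariationOn w univ) :
    {t | ¬ ContinuousAt w t}.Countable := by
  refine (variationFrom_monotone hw).countable_not_continuousAt.mono ?_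
  intro t (ht : ¬ ContinuousAt w t) (hV : ContinuousAt (variationFrom w) t)
  refine ht ?_
  rw [ContinuousAt, tendsto_iff_dist_tendsto_zero] at hV ⊢
  refine squeeze_zero (fun _ => dist_nonneg) (fun x => ?_) hV
  rcases le_total x t with h | h
  · rw [dist_comm (variationFrom w x), Real.dist_eq]
    exact (dist_le_variationFrom_sub hw h).trans (le_abs_self _)
  · rw [dist_comm, Real.dist_eq]
    exact (dist_le_variationFrom_sub hw h).trans (le_abs_self _)

section

variable [CompleteSpace E]

theorem tendsto_variationFrom_left (hw : BoundedVariationOn w univ) (t : ℝ) :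
    Tendsto (variationFrom w) (𝓝[<] t) (𝓝 (variationFrom w t - dist (w t) (w.leftLim t))) := by
  have := variationOnFromTo.tendsto_left (a := -1) (b := t) (mem_univ _) (mem_univ _)
    hw.locallyBoundedVariationOn (by simpa using hw.tendsto_leftLim t)
  simpa only [univ_inter] using! this

theorem tendsto_variationFrom_right (hw : BoundedVariationOn w univ) (t : ℝ) :
    Tendsto (variationFrom w) (𝓝[>] t) (𝓝 (variationFrom w t + dist (w t) (w.rightLim t))) := by
  have := variationOnFromTo.tendsto_right (a := -1) (b := t) (mem_univ _) (mem_univ _)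
    hw.locallyBoundedVariationOn (by simpa using hw.tendsto_rightLim t)
  simpa only [univ_inter] using! this

end

/-! ### The completed graph of a function of bounded variation -/

/-- The parameter `b(t) = t + ρ V(t)` at which the completed graph of `w` passes through the point
`(t, w t)`; here `V` is the variation of `w`. -/
def graphParam (ρ : ℝ) (w : ℝ → E) (t : ℝ) : ℝ :=
  t + ρ * variationFrom w t

/-- The parameter `a(t) = b(t-)` at which the completed graph passes through `(t, w (t-))`. -/
def graphParamLeft (ρ : ℝ) (w : ℝ → E) (t : ℝ) : ℝ :=
  graphParam ρ w t - ρ * dist (w t) (w.leftLim t)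

/-- The parameter `c(t) = b(t+)` at which the completed graph passes through `(t, w (t+))`. -/
def graphParamRight (ρ : ℝ) (w : ℝ → E) (t : ℝ) : ℝ :=
  graphParam ρ w t + ρ * dist (w t) (w.rightLim t)

/-- The time component of the completed graph: the generalized inverse of `graphParam`. -/
def graphTime (ρ : ℝ) (w : ℝ → E) (s : ℝ) : ℝ :=
  sSup {t | graphParam ρ w t ≤ s}

/-- The space component of the completed graph. A jump of `w` at `t` is filled in by the segments
from `w (t-)` to `w t` and from `w t` to `w (t+)`, each run through with speed `1 / ρ`. -/
def graphState [NormedSpace ℝ E] (ρ : ℝ) (w : ℝ → E) (s : ℝ) : E :=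
  let t := graphTime ρ w s
  if s ≤ graphParam ρ w t then
    w.leftLim t + ((s - graphParamLeft ρ w t) / (graphParam ρ w t - graphParamLeft ρ w t)) •
      (w t - w.leftLim t)
  else
    w t + ((s - graphParam ρ w t) / (graphParamRight ρ w t - graphParam ρ w t)) •
      (w.rightLim t - w t)

variable {ρ : ℝ}

theorem graphParam_sub_left (t : ℝ) :
    graphParam ρ w t - graphParamLeft ρ w t = ρ * ‖w t - w.leftLim t‖ := by
  rw [graphParamLeft, dist_eq_norm]; ring

theorem graphParam_right_sub (t : ℝ) :
    graphParamRight ρ w t - graphParam ρ w t = ρ * ‖w.rightLim t - w t‖ := by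
  rw [graphParamRight, dist_comm, dist_eq_norm]; ring

theorem graphParamLeft_le (hρ : 0 < ρ) (t : ℝ) : graphParamLeft ρ w t ≤ graphParam ρ w t := by
  have := graphParam_sub_left (ρ := ρ) (w := w) t
  have : 0 ≤ ρ * ‖w t - w.leftLim t‖ := by positivity
  linarith

theorem le_graphParamRight (hρ : 0 < ρ) (t : ℝ) : graphParam ρ w t ≤ graphParamRight ρ w t := by
  have := graphParam_right_sub (ρ := ρ) (w := w) t
  have : 0 ≤ ρ * ‖w.rightLim t - w t‖ := by positivity
  linarith

theorem le_graphParam_sub (hρ : 0 < ρ) (hw : BoundedVariationOn w univ) {x y : ℝ} (hxy : x ≤ y) :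
    y - x + ρ * dist (w x) (w y) ≤ graphParam ρ w y - graphParam ρ w x := by
  have := mul_le_mul_of_nonneg_left (dist_le_variationFrom_sub hw hxy) hρ.le
  simp only [graphParam]
  linarith

theorem graphParam_strictMono (hρ : 0 < ρ) (hw : BoundedVariationOn w univ) :
    StrictMono (graphParam ρ w) := fun x y hxy => by
  have := le_graphParam_sub hρ hw hxy.le
  have : 0 ≤ ρ * dist (w x) (w y) := by positivity
  linarith

theorem mul_dist_segment [NormedSpace ℝ E] {p q : E} {L x y : ℝ} (hL : L = ρ * ‖q - p‖)
    (hx : x ∈ Icc 0 L) (hy : y ∈ Icc 0 L) :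
    ρ * dist (p + (x / L) • (q - p)) (p + (y / L) • (q - p)) = |x - y| := by
  rw [dist_add_left, dist_eq_norm, ← sub_smul, norm_smul, Real.norm_eq_abs]
  rcases eq_or_ne L 0 with h | h
  · have hx0 : x = 0 := le_antisymm (h ▸ hx.2) hx.1
    have hy0 : y = 0 := le_antisymm (h ▸ hy.2) hy.1
    simp [hx0, hy0]
  · have hLpos : 0 < L := lt_of_le_of_ne (hx.1.trans hx.2) h.symm
    rw [← sub_div, abs_div, abs_of_pos hLpos]
    calc ρ * (|x - y| / L * ‖q - p‖) = |x - y| / L * (ρ * ‖q - p‖) := by ring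
      _ = |x - y| := by rw [← hL, div_mul_cancel₀ _ h]

section Complete

variable [CompleteSpace E]

theorem tendsto_graphParam_left (hw : BoundedVariationOn w univ) (t : ℝ) :
    Tendsto (graphParam ρ w) (𝓝[<] t) (𝓝 (graphParamLeft ρ w t)) := by
  have h := (tendsto_id.mono_left (nhdsWithin_le_nhds (a := t) (s := Iio t))).add
    ((tendsto_variationFrom_left hw t).const_mul ρ)
  convert! h using 2
  simp only [graphParamLeft, graphParam]; ring

theorem tendsto_graphParam_right (hw : BoundedVariationOn w univ) (t : ℝ) :
    Tendsto (graphParam ρ w) (𝓝[>] t) (𝓝 (graphParamRight ρ w t)) := by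
  have h := (tendsto_id.mono_left (nhdsWithin_le_nhds (a := t) (s := Ioi t))).add
    ((tendsto_variationFrom_right hw t).const_mul ρ)
  convert! h using 2
  simp only [graphParamRight, graphParam]; ring

theorem graphParam_continuousAt (hw : BoundedVariationOn w univ) {t : ℝ}
    (ht : ContinuousAt w t) : ContinuousAt (graphParam ρ w) t := by
  have hl : w.leftLim t = w t := leftLim_eq_of_tendsto (ht.tendsto.mono_left nhdsWithin_le_nhds)
  have hr : w.rightLim t = w t := rightLim_eq_of_tendsto (ht.tendsto.mono_left nhdsWithin_le_nhds)
  rw [continuousAt_iff_continuous_left'_right']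
  constructor
  · simpa [graphParamLeft, hl] using! tendsto_graphParam_left (ρ := ρ) hw t
  · simpa [graphParamRight, hr] using! tendsto_graphParam_right (ρ := ρ) hw t

theorem le_graphParamLeft_sub_right (hρ : 0 < ρ) (hw : BoundedVariationOn w univ) {x y : ℝ}
    (hxy : x < y) :
    y - x + ρ * dist (w.rightLim x) (w.leftLim y) ≤
      graphParamLeft ρ w y - graphParamRight ρ w x := by
  have h1 : ∀ u ∈ Ioo x y,
      y - u + ρ * dist (w u) (w.leftLim y) ≤ graphParamLeft ρ w y - graphParam ρ w u := by
    intro u hu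
    refine le_of_tendsto_of_tendsto (f := fun v => v - u + ρ * dist (w u) (w v))
      (((tendsto_id.mono_left nhdsWithin_le_nhds).sub_const u).add
        ((tendsto_const_nhds.dist (hw.tendsto_leftLim y)).const_mul ρ))
      ((tendsto_graphParam_left hw y).sub_const _) ?_
    filter_upwards [Ioo_mem_nhdsLT hu.2] with v hv
    exact le_graphParam_sub hρ hw hv.1.le
  refine le_of_tendsto_of_tendsto (f := fun u => y - u + ρ * dist (w u) (w.leftLim y))
    (((tendsto_id.mono_left nhdsWithin_le_nhds).const_sub y).add
      (((hw.tendsto_rightLim x).dist tendsto_const_nhds).const_mul ρ))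
    ((tendsto_graphParam_right hw x).const_sub _) ?_
  filter_upwards [Ioo_mem_nhdsGT hxy] with u hu using h1 u hu

theorem graphParamRight_lt_left (hρ : 0 < ρ) (hw : BoundedVariationOn w univ) {x y : ℝ}
    (hxy : x < y) : graphParamRight ρ w x < graphParamLeft ρ w y := by
  have := le_graphParamLeft_sub_right hρ hw hxy
  have : 0 ≤ ρ * dist (w.rightLim x) (w.leftLim y) := by positivity
  linarith

theorem graphParamLeft_monotone (hρ : 0 < ρ) (hw : BoundedVariationOn w univ) :
    Monotone (graphParamLeft ρ w) :=
  monotone_iff_forall_lt.2 fun x _ hxy => ((graphParamLeft_le hρ x).trans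
    (le_graphParamRight hρ x)).trans (graphParamRight_lt_left hρ hw hxy).le

theorem graphParamRight_monotone (hρ : 0 < ρ) (hw : BoundedVariationOn w univ) :
    Monotone (graphParamRight ρ w) :=
  monotone_iff_forall_lt.2 fun _ y hxy => (graphParamRight_lt_left hρ hw hxy).le.trans
    ((graphParamLeft_le hρ y).trans (le_graphParamRight hρ y))

theorem graphTime_spec (hρ : 0 < ρ) (hw : BoundedVariationOn w univ) (s : ℝ) :
    s ∈ Icc (graphParamLeft ρ w (graphTime ρ w s)) (graphParamRight ρ w (graphTime ρ w s)) := by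
  obtain ⟨C, hC⟩ := exists_abs_variationFrom_le hw
  have hb : ∀ t, |graphParam ρ w t - t| ≤ ρ * C := fun t => by
    simp only [graphParam, add_sub_cancel_left, abs_mul, abs_of_pos hρ]
    exact mul_le_mul_of_nonneg_left (hC t) hρ.le
  have hne : {t | graphParam ρ w t ≤ s}.Nonempty :=
    ⟨s - ρ * C, by have := (abs_le.1 (hb (s - ρ * C))).2; simp only [mem_ofPred_eq]; linarith⟩
  have hbdd : BddAbove {t | graphParam ρ w t ≤ s} :=
    ⟨s + ρ * C, fun t (ht : _ ≤ s) => by have := (abs_le.1 (hb t)).1; linarith⟩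
  constructor
  · refine le_of_tendsto (tendsto_graphParam_left hw _) ?_
    filter_upwards [self_mem_nhdsWithin] with x hx
    obtain ⟨t, ht, hxt⟩ := exists_lt_of_lt_csSup hne hx
    exact ((graphParam_strictMono hρ hw).monotone hxt.le).trans ht
  · refine ge_of_tendsto (tendsto_graphParam_right hw _) ?_
    filter_upwards [self_mem_nhdsWithin] with x hx
    by_contra! h
    exact (not_le_of_gt hx) (le_csSup hbdd h.le)

/-- The completed graph stays at time `t` exactly for the parameters between `b(t-)` and
`b(t+)`. -/
theorem graphTime_eq_iff (hρ : 0 < ρ) (hw : BoundedVariationOn w univ) {s t : ℝ} :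
    graphTime ρ w s = t ↔ s ∈ Icc (graphParamLeft ρ w t) (graphParamRight ρ w t) := by
  have h := graphTime_spec hρ hw s
  constructor
  · rintro rfl; exact h
  · intro ht
    rcases lt_trichotomy (graphTime ρ w s) t with h' | h' | h'
    · linarith [h.2, ht.1, graphParamRight_lt_left hρ hw h']
    · exact h'
    · linarith [h.1, ht.2, graphParamRight_lt_left hρ hw h']

theorem graphTime_graphParam (hρ : 0 < ρ) (hw : BoundedVariationOn w univ) (t : ℝ) :
    graphTime ρ w (graphParam ρ w t) = t :=
  (graphTime_eq_iff hρ hw).2 ⟨graphParamLeft_le hρ t, le_graphParamRight hρ t⟩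

theorem graphTime_monotone (hρ : 0 < ρ) (hw : BoundedVariationOn w univ) :
    Monotone (graphTime ρ w) := by
  intro s s' hs
  by_contra! h
  linarith [(graphTime_spec hρ hw s).1, (graphTime_spec hρ hw s').2,
    graphParamRight_lt_left hρ hw h]

variable [NormedSpace ℝ E]

theorem graphState_of_mem_left (hρ : 0 < ρ) (hw : BoundedVariationOn w univ) {s t : ℝ}
    (hs : s ∈ Icc (graphParamLeft ρ w t) (graphParam ρ w t)) :
    graphState ρ w s = w.leftLim t +
      ((s - graphParamLeft ρ w t) / (graphParam ρ w t - graphParamLeft ρ w t)) •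
        (w t - w.leftLim t) := by
  have ht : graphTime ρ w s = t :=
    (graphTime_eq_iff hρ hw).2 ⟨hs.1, hs.2.trans (le_graphParamRight hρ t)⟩
  simp only [graphState, ht, if_pos hs.2]

theorem graphState_graphParam (hρ : 0 < ρ) (hw : BoundedVariationOn w univ) (t : ℝ) :
    graphState ρ w (graphParam ρ w t) = w t := by
  rw [graphState_of_mem_left hρ hw ⟨graphParamLeft_le hρ t, le_rfl⟩]
  rcases eq_or_ne (w t) (w.leftLim t) with h | h
  · simp [h]
  · rw [div_self, one_smul, add_sub_cancel]
    rw [graphParam_sub_left]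
    exact mul_ne_zero hρ.ne' (norm_ne_zero_iff.2 (sub_ne_zero.2 h))

theorem graphState_of_mem_right (hρ : 0 < ρ) (hw : BoundedVariationOn w univ) {s t : ℝ}
    (hs : s ∈ Icc (graphParam ρ w t) (graphParamRight ρ w t)) :
    graphState ρ w s = w t +
      ((s - graphParam ρ w t) / (graphParamRight ρ w t - graphParam ρ w t)) •
        (w.rightLim t - w t) := by
  rcases hs.1.eq_or_lt with h | h
  · simp [← h, graphState_graphParam hρ hw]
  · have ht : graphTime ρ w s = t :=
      (graphTime_eq_iff hρ hw).2 ⟨(graphParamLeft_le hρ t).trans hs.1, hs.2⟩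
    simp only [graphState, ht, if_neg (not_le.2 h)]

theorem graphState_left (hρ : 0 < ρ) (hw : BoundedVariationOn w univ) (t : ℝ) :
    graphState ρ w (graphParamLeft ρ w t) = w.leftLim t := by
  rw [graphState_of_mem_left hρ hw ⟨le_rfl, graphParamLeft_le hρ t⟩]
  simp

theorem graphState_right (hρ : 0 < ρ) (hw : BoundedVariationOn w univ) (t : ℝ) :
    graphState ρ w (graphParamRight ρ w t) = w.rightLim t := by
  rw [graphState_of_mem_right hρ hw ⟨le_graphParamRight hρ t, le_rfl⟩]
  rcases eq_or_ne (w.rightLim t) (w t) with h | h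
  · simp [h]
  · rw [div_self, one_smul, add_sub_cancel]
    rw [graphParam_right_sub]
    exact mul_ne_zero hρ.ne' (norm_ne_zero_iff.2 (sub_ne_zero.2 h))

theorem mul_dist_graphState_le_of_mem (hρ : 0 < ρ) (hw : BoundedVariationOn w univ) {s s' t : ℝ}
    (hss : s ≤ s') (hs : graphParamLeft ρ w t ≤ s) (hs' : s' ≤ graphParamRight ρ w t) :
    ρ * dist (graphState ρ w s) (graphState ρ w s') ≤ s' - s := by
  have hL : ∀ {x y : ℝ}, graphParamLeft ρ w t ≤ x → x ≤ y → y ≤ graphParam ρ w t →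
      ρ * dist (graphState ρ w x) (graphState ρ w y) ≤ y - x := by
    intro x y hx hxy hy
    rw [graphState_of_mem_left hρ hw ⟨hx, hxy.trans hy⟩,
      graphState_of_mem_left hρ hw ⟨hx.trans hxy, hy⟩,
      mul_dist_segment (graphParam_sub_left t) ⟨by linarith, by linarith⟩
        ⟨by linarith, by linarith⟩, sub_sub_sub_cancel_right, abs_sub_comm,
      abs_of_nonneg (sub_nonneg.2 hxy)]
  have hR : ∀ {x y : ℝ}, graphParam ρ w t ≤ x → x ≤ y → y ≤ graphParamRight ρ w t →
      ρ * dist (graphState ρ w x) (graphState ρ w y) ≤ y - x := by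
    intro x y hx hxy hy
    rw [graphState_of_mem_right hρ hw ⟨hx, hxy.trans hy⟩,
      graphState_of_mem_right hρ hw ⟨hx.trans hxy, hy⟩,
      mul_dist_segment (graphParam_right_sub t) ⟨by linarith, by linarith⟩
        ⟨by linarith, by linarith⟩, sub_sub_sub_cancel_right, abs_sub_comm,
      abs_of_nonneg (sub_nonneg.2 hxy)]
  rcases le_total s' (graphParam ρ w t) with h | h
  · exact hL hs hss h
  rcases le_total (graphParam ρ w t) s with h' | h'
  · exact hR h' hss hs'
  · have h1 := hL hs h' le_rfl
    have h2 := hR le_rfl h hs'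
    have h3 := mul_le_mul_of_nonneg_left (dist_triangle (graphState ρ w s)
      (graphState ρ w (graphParam ρ w t)) (graphState ρ w s')) hρ.le
    linarith

/-- The parametrization of the completed graph is normalized: what the parameter does not spend on
the time component bounds the motion of the space component. -/
theorem mul_dist_graphState_le (hρ : 0 < ρ) (hw : BoundedVariationOn w univ) {s s' : ℝ}
    (hss : s ≤ s') :
    ρ * dist (graphState ρ w s) (graphState ρ w s') ≤
      (s' - graphTime ρ w s') - (s - graphTime ρ w s) := by
  have hs := graphTime_spec hρ hw s
  have hs' := graphTime_spec hρ hw s'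
  rcases (graphTime_monotone hρ hw hss).eq_or_lt with h | h
  · rw [← h] at hs' ⊢
    have := mul_dist_graphState_le_of_mem hρ hw hss hs.1 hs'.2
    linarith
  · have h1 := mul_dist_graphState_le_of_mem hρ hw hs.2 hs.1 le_rfl
    have h2 := mul_dist_graphState_le_of_mem hρ hw hs'.1 le_rfl hs'.2
    have h3 := le_graphParamLeft_sub_right hρ hw h
    rw [graphState_right hρ hw] at h1
    rw [graphState_left hρ hw] at h2
    have h4 := mul_le_mul_of_nonneg_left (dist_triangle4 (graphState ρ w s)
      (w.rightLim (graphTime ρ w s)) (w.leftLim (graphTime ρ w s')) (graphState ρ w s')) hρ.le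
    linarith

theorem graphTime_lipschitz (hρ : 0 < ρ) (hw : BoundedVariationOn w univ) :
    LipschitzWith 1 (graphTime ρ w) := by
  refine LipschitzWith.of_le_add_mul _ fun x y => ?_
  rw [NNReal.coe_one, one_mul, Real.dist_eq]
  rcases le_total x y with h | h
  · have := graphTime_monotone hρ hw h
    have := abs_nonneg (x - y)
    linarith
  · have h1 := mul_dist_graphState_le hρ hw h
    have h2 : 0 ≤ ρ * dist (graphState ρ w y) (graphState ρ w x) := by positivity
    have := le_abs_self (x - y)
    linarith

theorem graphState_lipschitz (hρ : 0 < ρ) (hw : BoundedVariationOn w univ) :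
    LipschitzWith (Real.toNNReal ρ⁻¹) (graphState ρ w) := by
  have key : ∀ {x y : ℝ}, x ≤ y → dist (graphState ρ w x) (graphState ρ w y) ≤ ρ⁻¹ * (y - x) := by
    intro x y h
    have h1 := mul_dist_graphState_le hρ hw h
    have h2 := graphTime_monotone hρ hw h
    rw [inv_mul_eq_div, le_div_iff₀' hρ]
    linarith
  refine LipschitzWith.of_dist_le_mul fun x y => ?_
  rw [Real.coe_toNNReal _ (inv_nonneg.2 hρ.le), Real.dist_eq]
  rcases le_total x y with h | h
  · rw [abs_sub_comm, abs_of_nonneg (sub_nonneg.2 h)]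
    exact key h
  · rw [dist_comm, abs_of_nonneg (sub_nonneg.2 h)]
    exact key h

end Complete

end Graph

/-! ### Lipschitz curves -/

section Lipschitz

variable {E : Type*} [NormedAddCommGroup E] [NormedSpace ℝ E] [FiniteDimensional ℝ E]
  {u : ℝ → E} {K : ℝ≥0}

theorem deriv_aestronglyMeasurable (μ : Measure ℝ) : AEStronglyMeasurable (deriv u) μ := by
  have := FiniteDimensional.complete ℝ E
  exact (stronglyMeasurable_deriv u).aestronglyMeasurable

theorem intervalIntegrable_deriv_of_lipschitz (hu : LipschitzWith K u) (a b : ℝ) :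
    IntervalIntegrable (deriv u) volume a b := by
  refine (intervalIntegrable_const (c := (K : ℝ))).mono_fun (deriv_aestronglyMeasurable _) ?_
  refine Eventually.of_forall fun s => ?_
  simpa using norm_deriv_le_of_lipschitz hu (x₀ := s)

/-- The fundamental theorem of calculus for Lipschitz curves; it follows from the scalar case by
testing with linear functionals. -/
theorem integral_deriv_of_lipschitz (hu : LipschitzWith K u) (a b : ℝ) :
    ∫ s in a..b, deriv u s = u b - u a := by
  have := FiniteDimensional.complete ℝ E
  refine (SeparatingDual.eq_iff_forall_dual_eq (R := ℝ)).2 fun g => ?_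
  have hg : LipschitzWith (‖g‖₊ * K) (g ∘ u) := g.lipschitz.comp hu
  calc g (∫ s in a..b, deriv u s) = ∫ s in a..b, g (deriv u s) :=
        (g.intervalIntegral_comp_comm (intervalIntegrable_deriv_of_lipschitz hu a b)).symm
    _ = ∫ s in a..b, deriv (g ∘ u) s := by
        refine intervalIntegral.integral_congr_ae ?_
        filter_upwards [hu.ae_differentiableAt_real] with s hs _
        exact (g.hasFDerivAt.comp_hasDerivAt s hs.hasDerivAt).deriv.symm
    _ = g (u b - u a) := by
        rw [(hg.lipschitzOnWith.absolutelyContinuousOnInterval).integral_deriv_eq_sub, map_sub]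
        rfl

/-- A Lipschitz curve belongs to `W^{1,∞}`, and its a.e. derivative is its weak derivative:
integrate by parts after testing with linear functionals. -/
theorem isW1Infty_of_lipschitz (hu : LipschitzWith K u) {S : ℝ} (hS : 0 ≤ S) :
    IsW1Infty S u (deriv u) where
  continuousOn := hu.continuous.continuousOn
  memLp := by
    obtain ⟨C, hC⟩ := (isCompact_Icc (a := (0 : ℝ)) (b := S)).exists_bound_of_continuousOn
      hu.continuous.continuousOn
    refine MemLp.of_bound hu.continuous.aestronglyMeasurable C ?_
    filter_upwards [ae_restrict_mem measurableSet_Ioo] with s hs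
    exact hC s (Ioo_subset_Icc_self hs)
  memLp_deriv := MemLp.of_bound (deriv_aestronglyMeasurable _) K
    (Eventually.of_forall fun s => norm_deriv_le_of_lipschitz hu)
  weakDeriv := by
    intro φ hφ hφc hφS
    have := FiniteDimensional.complete ℝ E
    have h0 : φ 0 = 0 := image_eq_zero_of_notMem_tsupport fun h => lt_irrefl _ (hφS h).1
    have h1 : φ S = 0 := image_eq_zero_of_notMem_tsupport fun h => lt_irrefl _ (hφS h).2
    have hu1 : Continuous u := hu.continuous
    have hi1 : IntervalIntegrable (fun s => deriv φ s • u s) volume 0 S :=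
      ((hφ.continuous_deriv (by simp)).smul hu1).intervalIntegrable _ _
    have hi2 : IntervalIntegrable (fun s => φ s • deriv u s) volume 0 S :=
      (intervalIntegrable_deriv_of_lipschitz hu 0 S).continuousOn_smul hφ.continuous.continuousOn
    rw [← integral_Ioc_eq_integral_Ioo, ← integral_Ioc_eq_integral_Ioo,
      ← intervalIntegral.integral_of_le hS, ← intervalIntegral.integral_of_le hS,
      eq_neg_iff_add_eq_zero, ← intervalIntegral.integral_add hi1 hi2]
    refine (SeparatingDual.eq_iff_forall_dual_eq (R := ℝ)).2 fun g => ?_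
    have hφ1 : ContDiff ℝ 1 φ := hφ.of_le (by simp)
    have hφa : AbsolutelyContinuousOnInterval φ 0 S :=
      hφ1.contDiffOn.absolutelyContinuousOnInterval
    have hg : LipschitzWith (‖g‖₊ * K) (g ∘ u) := g.lipschitz.comp hu
    have hga : AbsolutelyContinuousOnInterval (g ∘ u) 0 S :=
      (hg.lipschitzOnWith (s := uIcc 0 S)).absolutelyContinuousOnInterval
    have key := hφa.integral_deriv_mul_eq_sub hga
    rw [h0, h1, zero_mul, zero_mul, sub_zero] at key
    rw [← g.intervalIntegral_comp_comm (hi1.add hi2), map_zero]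
    refine (intervalIntegral.integral_congr_ae ?_).trans key
    filter_upwards [hu.ae_differentiableAt_real] with s hs _
    have hd : deriv (g ∘ u) s = g (deriv u s) :=
      (g.hasFDerivAt.comp_hasDerivAt s hs.hasDerivAt).deriv
    simp only [map_add, map_smul, smul_eq_mul, hd, comp_apply]

end Lipschitz

theorem ae_eq_zero_of_integral_nonpos {h : ℝ → ℝ} {a b : ℝ} (hab : a ≤ b)
    (hi : IntervalIntegrable h volume a b) (h0 : ∀ᵐ s, s ∈ Ioc a b → 0 ≤ h s)
    (hint : ∫ s in a..b, h s ≤ 0) : ∀ᵐ s, s ∈ Ioc a b → h s = 0 := by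
  rw [← ae_restrict_iff' measurableSet_Ioc] at h0 ⊢
  rw [intervalIntegral.integral_of_le hab] at hint
  exact (integral_eq_zero_iff_of_nonneg_ae h0 ((intervalIntegrable_iff_integrableOn_Ioc_of_le
    hab).1 hi)).1 (le_antisymm hint (integral_nonneg_of_ae h0))

section GraphDeriv

variable {E : Type*} [NormedAddCommGroup E] [NormedSpace ℝ E] [CompleteSpace E]
  {w : ℝ → E} {ρ : ℝ}

theorem mul_norm_deriv_graphState_le (hρ : 0 < ρ)
    (hw : BoundedVariationOn w univ) {s : ℝ} (ht : DifferentiableAt ℝ (graphTime ρ w) s)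
    (hz : DifferentiableAt ℝ (graphState ρ w) s) :
    ρ * ‖deriv (graphState ρ w) s‖ ≤ 1 - deriv (graphTime ρ w) s := by
  have h1 := hz.hasDerivAt.tendsto_slope.mono_left (nhdsGT_le_nhdsNE s)
  have h2 := ht.hasDerivAt.tendsto_slope.mono_left (nhdsGT_le_nhdsNE s)
  refine le_of_tendsto_of_tendsto (h1.norm.const_mul ρ) (h2.const_sub 1) ?_
  filter_upwards [self_mem_nhdsWithin] with y (hy : s < y)
  have hy' : 0 < y - s := sub_pos.2 hy
  have h3 := mul_dist_graphState_le hρ hw hy.le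
  rw [dist_comm, dist_eq_norm] at h3
  rw [slope_def_module, slope_def_field, norm_smul, norm_inv, Real.norm_of_nonneg hy'.le,
    mul_left_comm, inv_mul_eq_div, div_le_iff₀ hy', sub_mul, one_mul, div_mul_cancel₀ _ hy'.ne']
  linarith

variable [FiniteDimensional ℝ E]

theorem variationFrom_sub_le_integral (hρ : 0 < ρ)
    (hw : BoundedVariationOn w univ) {x y : ℝ} (hxy : x ≤ y) :
    variationFrom w y - variationFrom w x ≤
      ∫ s in graphParam ρ w x..graphParam ρ w y, ‖deriv (graphState ρ w) s‖ := by
  have hlip := graphState_lipschitz hρ hw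
  have hmono := (graphParam_strictMono hρ hw).monotone
  have hint : ∀ p q, IntervalIntegrable (fun s => ‖deriv (graphState ρ w) s‖) volume p q :=
    fun p q => (intervalIntegrable_deriv_of_lipschitz hlip p q).norm
  have hnn : ∀ {p q : ℝ}, p ≤ q → 0 ≤ ∫ s in p..q, ‖deriv (graphState ρ w) s‖ := fun h =>
    intervalIntegral.integral_nonneg h fun _ _ => norm_nonneg _
  rw [variationFrom_sub hw hxy]
  refine ENNReal.toReal_le_of_le_ofReal (hnn (hmono hxy)) (iSup_le ?_)
  rintro ⟨n, p, hp, hpm⟩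
  simp only
  have hstep : ∀ i, edist (w (p (i + 1))) (w (p i)) ≤ ENNReal.ofReal
      (∫ s in graphParam ρ w (p i)..graphParam ρ w (p (i + 1)), ‖deriv (graphState ρ w) s‖) := by
    intro i
    rw [edist_dist, dist_eq_norm]
    refine ENNReal.ofReal_le_ofReal ?_
    rw [← graphState_graphParam hρ hw (p (i + 1)), ← graphState_graphParam hρ hw (p i),
      ← integral_deriv_of_lipschitz hlip]
    exact intervalIntegral.norm_integral_le_integral_norm (hmono (hp i.le_succ))
  refine (Finset.sum_le_sum fun i _ => hstep i).trans ?_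
  rw [← ENNReal.ofReal_sum_of_nonneg fun i _ => hnn (hmono (hp i.le_succ)),
    intervalIntegral.sum_integral_adjacent_intervals fun i _ => hint _ _]
  refine ENNReal.ofReal_le_ofReal ?_
  exact intervalIntegral.integral_mono_interval (hmono (hpm 0).1) (hmono (hp n.zero_le))
    (hmono (hpm n).2) (Eventually.of_forall fun _ => norm_nonneg _) (hint _ _)

/-- The parametrization of the completed graph is exactly normalized: the bound of
`mul_norm_deriv_graphState_le` is an equality almost everywhere, because both sides have the same
integral, namely `ρ` times the variation of `w`. -/
theorem ae_deriv_graphTime_add (hρ : 0 < ρ) (hw : BoundedVariationOn w univ)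
    {x y : ℝ} (hxy : x ≤ y) :
    ∀ᵐ s, s ∈ Ioc (graphParam ρ w x) (graphParam ρ w y) →
      deriv (graphTime ρ w) s + ρ * ‖deriv (graphState ρ w) s‖ = 1 := by
  have hT := graphTime_lipschitz hρ hw
  have hZ := graphState_lipschitz hρ hw
  have hTi := intervalIntegrable_deriv_of_lipschitz hT (graphParam ρ w x) (graphParam ρ w y)
  have hZi := (intervalIntegrable_deriv_of_lipschitz hZ (graphParam ρ w x)
    (graphParam ρ w y)).norm.const_mul ρ
  have h1i := (intervalIntegrable_const (c := (1 : ℝ)) (μ := volume) (a := graphParam ρ w x)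
    (b := graphParam ρ w y))
  have key := ae_eq_zero_of_integral_nonpos
    (h := fun s => (1 - deriv (graphTime ρ w) s) - ρ * ‖deriv (graphState ρ w) s‖)
    ((graphParam_strictMono hρ hw).monotone hxy) ((h1i.sub hTi).sub hZi) ?_ ?_
  · filter_upwards [key] with s hs hs'
    linarith [hs hs']
  · filter_upwards [hT.ae_differentiableAt_real, hZ.ae_differentiableAt_real] with s h1 h2 _
    exact sub_nonneg.2 (mul_norm_deriv_graphState_le hρ hw h1 h2)
  · rw [intervalIntegral.integral_sub (h1i.sub hTi) hZi, intervalIntegral.integral_sub h1i hTi,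
      integral_deriv_of_lipschitz hT, intervalIntegral.integral_const_mul,
      graphTime_graphParam hρ hw, graphTime_graphParam hρ hw]
    have := mul_le_mul_of_nonneg_left (variationFrom_sub_le_integral hρ hw hxy) hρ.le
    simp only [intervalIntegral.integral_const, smul_eq_mul, mul_one]
    simp only [graphParam] at this ⊢
    linarith

theorem integral_mul_norm_deriv_graphState (hρ : 0 < ρ)
    (hw : BoundedVariationOn w univ) {x y : ℝ} (hxy : x ≤ y) :
    ∫ s in graphParam ρ w x..graphParam ρ w y, ρ * ‖deriv (graphState ρ w) s‖ =
      ρ * (variationFrom w y - variationFrom w x) := by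
  have hT := graphTime_lipschitz hρ hw
  have hTi := intervalIntegrable_deriv_of_lipschitz hT (graphParam ρ w x) (graphParam ρ w y)
  calc _ = ∫ s in graphParam ρ w x..graphParam ρ w y, (1 - deriv (graphTime ρ w) s) := by
        refine intervalIntegral.integral_congr_ae ?_
        rw [uIoc_of_le ((graphParam_strictMono hρ hw).monotone hxy)]
        filter_upwards [ae_deriv_graphTime_add hρ hw hxy] with s hs hs'
        linarith [hs hs']
    _ = _ := by
        rw [intervalIntegral.integral_sub intervalIntegrable_const hTi,
          integral_deriv_of_lipschitz hT, graphTime_graphParam hρ hw, graphTime_graphParam hρ hw]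
        simp only [intervalIntegral.integral_const, smul_eq_mul, mul_one, graphParam]
        ring

end GraphDeriv

/-! ### Partitions, dissipation and the Kurzweil integral -/

theorem IsPartition.le {a b : ℝ} {n : ℕ} {x : ℕ → ℝ} (h : IsPartition a b n x) {i j : ℕ}
    (hij : i ≤ j) (hj : j ≤ n) : x i ≤ x j := by
  induction j, hij using Nat.le_induction with
  | base => exact le_rfl
  | succ j _ ih => exact (ih (by omega)).trans (h.2.2 j (by omega)).le

theorem IsPartition.mem_Icc {a b : ℝ} {n : ℕ} {x : ℕ → ℝ} (h : IsPartition a b n x) {i : ℕ}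
    (hi : i ≤ n) : x i ∈ Icc a b :=
  ⟨h.1 ▸ h.le i.zero_le hi, h.2.1 ▸ h.le hi le_rfl⟩

theorem IsPartition.snoc {a b c : ℝ} {n : ℕ} {x : ℕ → ℝ} (h : IsPartition a b n x) (hbc : b < c) :
    IsPartition a c (n + 1) (update x (n + 1) c) := by
  refine ⟨by rw [update_of_ne (by omega), h.1], update_self .., fun i hi => ?_⟩
  rw [update_of_ne (by omega)]
  rcases Nat.lt_succ_iff_lt_or_eq.1 hi with h' | rfl
  · rw [update_of_ne (by omega)]; exact h.2.2 i h'
  · rw [update_self, h.2.1]; exact hbc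

/-- There is a tagged partition of `[a, b]` that is fine with respect to the gauge `δ`. -/
def HasFinePartition (δ : ℝ → ℝ) (a b : ℝ) : Prop :=
  ∃ (n : ℕ) (x τ : ℕ → ℝ), IsPartition a b n x ∧
    ∀ i < n, τ i ∈ Icc (x i) (x (i + 1)) ∧
      Icc (x i) (x (i + 1)) ⊆ Ioo (τ i - δ (τ i)) (τ i + δ (τ i))

theorem HasFinePartition.extend {δ : ℝ → ℝ} {a b c t : ℝ} (h : HasFinePartition δ a b)
    (hbc : b ≤ c) (ht : t ∈ Icc b c) (hfine : Icc b c ⊆ Ioo (t - δ t) (t + δ t)) :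
    HasFinePartition δ a c := by
  rcases hbc.eq_or_lt with rfl | hbc
  · exact h
  obtain ⟨n, x, τ, hx, hτ⟩ := h
  refine ⟨n + 1, _, update τ n t, hx.snoc hbc, fun i hi => ?_⟩
  rw [update_of_ne (a := i) (a' := n + 1) (by omega)]
  rcases Nat.lt_succ_iff_lt_or_eq.1 hi with h' | rfl
  · rw [update_of_ne (by omega), update_of_ne (by omega)]
    exact hτ i h'
  · rw [update_self, update_self, hx.2.1]
    exact ⟨ht, hfine⟩

/-- Cousin's lemma: every gauge on `[a, b]` admits a fine tagged partition. -/
theorem hasFinePartition {δ : ℝ → ℝ} {a b : ℝ} (hab : a ≤ b) (hδ : ∀ t ∈ Icc a b, 0 < δ t) :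
    HasFinePartition δ a b := by
  let P : Set ℝ := {c ∈ Icc a b | HasFinePartition δ a c}
  have haP : a ∈ P := ⟨left_mem_Icc.2 hab, 0, fun _ => a, fun _ => a, ⟨rfl, rfl, by simp⟩, by simp⟩
  have hbdd : BddAbove P := ⟨b, fun c hc => hc.1.2⟩
  have hc : sSup P ∈ Icc a b := ⟨le_csSup hbdd haP, csSup_le ⟨a, haP⟩ fun c hc => hc.1.2⟩
  set c := sSup P
  have hδc := hδ c hc
  obtain ⟨c', hc', hcc'⟩ := exists_lt_of_lt_csSup ⟨a, haP⟩ (show c - δ c < c by linarith)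
  have hle : c' ≤ c := le_csSup hbdd hc'
  have hy : min b (c + δ c / 2) ∈ P := by
    refine ⟨⟨le_min hab (by linarith [hc.1]), min_le_left _ _⟩, ?_⟩
    have h1 : c ≤ min b (c + δ c / 2) := le_min hc.2 (by linarith)
    refine hc'.2.extend (hle.trans h1) ⟨hle, h1⟩ fun v hv => ⟨by linarith [hv.1], ?_⟩
    linarith [hv.2, min_le_right b (c + δ c / 2)]
  have h2 : min b (c + δ c / 2) ≤ c := le_csSup hbdd hy
  rcases min_le_iff.1 h2 with h | h
  · have := hy.2
    rwa [min_eq_left (by linarith)] at this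
  · linarith

theorem exists_isPartition_sum_eq {d : ℕ} {R : Vec d → ℝ} (hR : R 0 = 0) (w : ℝ → Vec d)
    {u : ℕ → ℝ} (hu : Monotone u) (n : ℕ) :
    ∃ (m : ℕ) (x : ℕ → ℝ), IsPartition (u 0) (u n) m x ∧
      ∑ i ∈ Finset.range m, R (w (x (i + 1)) - w (x i)) =
        ∑ i ∈ Finset.range n, R (w (u (i + 1)) - w (u i)) := by
  induction n with
  | zero => exact ⟨0, fun _ => u 0, ⟨rfl, rfl, by simp⟩, by simp⟩
  | succ n ih =>
    obtain ⟨m, x, hx, hsum⟩ := ih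
    rcases (hu n.le_succ).eq_or_lt with h | h
    · refine ⟨m, x, by rwa [← h], ?_⟩
      rw [Finset.sum_range_succ, ← h, sub_self, hR, add_zero, hsum]
    · refine ⟨m + 1, _, hx.snoc h, ?_⟩
      rw [Finset.sum_range_succ, Finset.sum_range_succ, ← hsum, update_self,
        update_of_ne (by omega), hx.2.1]
      congr 1
      refine Finset.sum_congr rfl fun i hi => ?_
      have := Finset.mem_range.1 hi
      rw [update_of_ne (by omega), update_of_ne (by omega)]

theorem diss_congr {d : ℕ} {R : Vec d → ℝ} {w z : ℝ → Vec d} {a b : ℝ}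
    (h : EqOn w z (Icc a b)) : diss R w a b = diss R z a b := by
  unfold diss
  congr 1
  ext v
  refine exists_congr fun n => exists_congr fun x => and_congr_right fun hx => ?_
  rw [Finset.sum_congr rfl fun i hi => ?_]
  have hi := Finset.mem_range.1 hi
  rw [h (hx.mem_Icc hi), h (hx.mem_Icc hi.le)]

theorem hasKurzweilIntegral_congr {d : ℕ} {f f' g g' : ℝ → Vec d} {a b J : ℝ}
    (hf : EqOn f f' (Icc a b)) (hg : EqOn g g' (Icc a b)) (h : HasKurzweilIntegral f g a b J) :
    HasKurzweilIntegral f' g' a b J := by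
  intro ε hε
  obtain ⟨δ, hδ, H⟩ := h ε hε
  refine ⟨δ, hδ, fun n x τ hx hτ => ?_⟩
  convert H n x τ hx hτ using 4 with i hi
  have hi := Finset.mem_range.1 hi
  have h0 := hx.mem_Icc hi
  have h1 := hx.mem_Icc hi.le
  rw [hg h0, hg h1, hf ⟨h1.1.trans (hτ i hi).1.1, (hτ i hi).1.2.trans h0.2⟩]

/-- The dissipation for `R = ρ ‖·‖` is at least `ρ` times the variation. -/
theorem mul_variationFrom_sub_le_diss {d : ℕ} {R : Vec d → ℝ} {ρ : ℝ} (hρ : 0 < ρ)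
    (hR : ∀ v, R v = ρ * ‖v‖) {w : ℝ → Vec d} (hw : BoundedVariationOn w univ) {a b : ℝ}
    (hab : a ≤ b) : ρ * (variationFrom w b - variationFrom w a) ≤ diss R w a b := by
  have hR0 : R 0 = 0 := by simp [hR]
  have hRnn : ∀ v, 0 ≤ R v := fun v => by rw [hR]; positivity
  have hbdd : BddAbove {v | ∃ (n : ℕ) (x : ℕ → ℝ), IsPartition a b n x ∧
      v = ∑ i ∈ Finset.range n, R (w (x (i + 1)) - w (x i))} := by
    refine ⟨ρ * (variationFrom w b - variationFrom w a), ?_⟩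
    rintro _ ⟨n, x, hx, rfl⟩
    calc ∑ i ∈ Finset.range n, R (w (x (i + 1)) - w (x i))
        ≤ ∑ i ∈ Finset.range n, ρ * (variationFrom w (x (i + 1)) - variationFrom w (x i)) := by
          refine Finset.sum_le_sum fun i hi => ?_
          rw [hR, ← dist_eq_norm, dist_comm]
          exact mul_le_mul_of_nonneg_left
            (dist_le_variationFrom_sub hw (hx.2.2 i (Finset.mem_range.1 hi)).le) hρ.le
      _ = _ := by
          rw [← Finset.mul_sum, Finset.sum_range_sub (fun i => variationFrom w (x i)), hx.1, hx.2.1]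
  have hnn : 0 ≤ diss R w a b := by
    refine Real.sSup_nonneg ?_
    rintro _ ⟨n, x, -, rfl⟩
    exact Finset.sum_nonneg fun i _ => hRnn _
  rw [variationFrom_sub hw hab, ← le_div_iff₀' hρ]
  refine ENNReal.toReal_le_of_le_ofReal (by positivity) (iSup_le ?_)
  rintro ⟨n, u, hu, hum⟩
  simp only [edist_dist]
  rw [← ENNReal.ofReal_sum_of_nonneg fun i _ => dist_nonneg]
  refine ENNReal.ofReal_le_ofReal ?_
  rw [le_div_iff₀' hρ, Finset.mul_sum]
  -- complete the chain `u 0 ≤ ⋯ ≤ u n` by the end points of the interval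
  let v : ℕ → ℝ := fun i => if i = 0 then a else if i ≤ n + 1 then u (i - 1) else b
  have hv0 : v 0 = a := rfl
  have hvs : ∀ i ≤ n, v (i + 1) = u i := fun i hi => by simp [v, hi]
  have hvn : v (n + 2) = b := by simp [v]
  have hv : Monotone v := by
    refine monotone_nat_of_le_succ fun i => ?_
    rcases i with _ | i
    · rw [hv0, hvs 0 n.zero_le]; exact (hum 0).1
    · rcases lt_trichotomy i n with h | rfl | h
      · rw [hvs i h.le, hvs (i + 1) h]; exact hu i.le_succ
      · rw [hvs i le_rfl, hvn]; exact (hum i).2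
      · have h1 : ¬ i ≤ n := by omega
        have h2 : ¬ i + 1 ≤ n := by omega
        simp [v, h1, h2]
  obtain ⟨m, x, hx, hsum⟩ := exists_isPartition_sum_eq hR0 w hv (n + 2)
  rw [hv0, hvn] at hx
  refine le_trans ?_ (le_csSup hbdd ⟨m, x, hx, rfl⟩)
  rw [hsum, Finset.sum_range_succ, Finset.sum_range_succ']
  have h1 : ∑ i ∈ Finset.range n, ρ * dist (w (u (i + 1))) (w (u i)) =
      ∑ i ∈ Finset.range n, R (w (v (i + 1 + 1)) - w (v (i + 1))) := by
    refine Finset.sum_congr rfl fun i hi => ?_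
    have hi := Finset.mem_range.1 hi
    rw [hvs i hi.le, hvs (i + 1) hi, hR, dist_eq_norm]
  rw [h1]
  have h2 := hRnn (w (v (0 + 1)) - w (v 0))
  have h3 := hRnn (w (v (n + 1 + 1)) - w (v (n + 1)))
  linarith

theorem stronglyMeasurable_of_boundedVariationOn {d : ℕ} {l : ℝ → Vec d}
    (hl : BoundedVariationOn l univ) : StronglyMeasurable l :=
  StronglyMeasurable.of_countable_not_continuousAt (countable_not_continuousAt hl)

theorem exists_norm_le_of_boundedVariationOn {d : ℕ} {l : ℝ → Vec d}
    (hl : BoundedVariationOn l univ) : ∃ C, ∀ t, ‖l t‖ ≤ C :=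
  ⟨‖l 0‖ + (eVariationOn l univ).toReal, fun t => by
    have h1 := hl.dist_le (mem_univ t) (mem_univ 0)
    rw [dist_eq_norm] at h1
    linarith [norm_le_norm_add_norm_sub' (l t) (l 0)]⟩

section Kurzweil

variable {d : ℕ} {w l : ℝ → Vec d} {ρ : ℝ}

theorem norm_deriv_graphState_le (hρ : 0 < ρ) (hw : BoundedVariationOn w univ) (s : ℝ) :
    ‖deriv (graphState ρ w) s‖ ≤ ρ⁻¹ := by
  simpa [inv_nonneg.2 hρ.le] using
    norm_deriv_le_of_lipschitz (graphState_lipschitz hρ hw) (x₀ := s)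

theorem intervalIntegrable_inner_load (hρ : 0 < ρ) (hw : BoundedVariationOn w univ)
    (hl : BoundedVariationOn l univ) (p q : ℝ) :
    IntervalIntegrable (fun s => inner ℝ (l (graphTime ρ w s)) (deriv (graphState ρ w) s))
      volume p q := by
  obtain ⟨C, hC⟩ := exists_norm_le_of_boundedVariationOn hl
  have hm : AEStronglyMeasurable (fun s => l (graphTime ρ w s)) volume :=
    ((stronglyMeasurable_of_boundedVariationOn hl).comp_measurable
      (graphTime_lipschitz hρ hw).continuous.measurable).aestronglyMeasurable
  refine (intervalIntegrable_const (c := C * ρ⁻¹)).mono_fun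
    (hm.inner (deriv_aestronglyMeasurable _)).restrict (Eventually.of_forall fun s => ?_)
  refine (norm_inner_le_norm _ _).trans (le_trans ?_ (le_abs_self _))
  exact mul_le_mul (hC _) (norm_deriv_graphState_le hρ hw s) (norm_nonneg _)
    ((norm_nonneg _).trans (hC 0))

theorem abs_inner_sub_le (hρ : 0 < ρ) (hw : BoundedVariationOn w univ)
    (hl : BoundedVariationOn l univ) {x y τ ε : ℝ} (hxy : x ≤ y) (hε : dist (w τ) (w y) ≤ ε)
    (hε' : graphParam ρ w y - graphParam ρ w x ≤ ε) :
    |inner ℝ (w τ) (l y - l x) - (inner ℝ (w y) (l y) - inner ℝ (w x) (l x)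
        - ∫ s in graphParam ρ w x..graphParam ρ w y,
            inner ℝ (l (graphTime ρ w s)) (deriv (graphState ρ w) s))|
      ≤ (ε + ρ⁻¹ * ε) * (variationFrom l y - variationFrom l x) := by
  have hmono := (graphParam_strictMono hρ hw).monotone hxy
  have hlip := graphState_lipschitz hρ hw
  have hV : ‖l y - l x‖ ≤ variationFrom l y - variationFrom l x := by
    rw [← dist_eq_norm, dist_comm]; exact dist_le_variationFrom_sub hl hxy
  have hV0 := (norm_nonneg _).trans hV
  have hi := intervalIntegrable_inner_load (ρ := ρ) hρ hw hl (graphParam ρ w x) (graphParam ρ w y)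
  have hdi := intervalIntegrable_deriv_of_lipschitz hlip (graphParam ρ w x) (graphParam ρ w y)
  have hci : IntervalIntegrable (fun s => inner ℝ (l x) (deriv (graphState ρ w) s)) volume
      (graphParam ρ w x) (graphParam ρ w y) :=
    ⟨(innerSL ℝ (l x)).integrable_comp hdi.1, (innerSL ℝ (l x)).integrable_comp hdi.2⟩
  have h1 : ∫ s in graphParam ρ w x..graphParam ρ w y, inner ℝ (l x) (deriv (graphState ρ w) s) =
      inner ℝ (l x) (w y - w x) := by
    have := (innerSL ℝ (l x)).intervalIntegral_comp_comm hdi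
    simp only [innerSL_apply_apply] at this
    rw [this, integral_deriv_of_lipschitz hlip, graphState_graphParam hρ hw,
      graphState_graphParam hρ hw]
  have h2 : inner ℝ (w τ) (l y - l x) - (inner ℝ (w y) (l y) - inner ℝ (w x) (l x)
        - ∫ s in graphParam ρ w x..graphParam ρ w y,
            inner ℝ (l (graphTime ρ w s)) (deriv (graphState ρ w) s)) =
      inner ℝ (w τ - w y) (l y - l x) + ∫ s in graphParam ρ w x..graphParam ρ w y,
        (inner ℝ (l (graphTime ρ w s)) (deriv (graphState ρ w) s) -
          inner ℝ (l x) (deriv (graphState ρ w) s)) := by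
    rw [intervalIntegral.integral_sub hi hci, h1]
    simp only [inner_sub_left, inner_sub_right, real_inner_comm]
    ring
  have h3 : |inner ℝ (w τ - w y) (l y - l x)| ≤
      ε * (variationFrom l y - variationFrom l x) := by
    refine (abs_real_inner_le_norm _ _).trans ?_
    rw [dist_eq_norm] at hε
    exact mul_le_mul hε hV (norm_nonneg _) ((norm_nonneg _).trans hε)
  have h4 : |∫ s in graphParam ρ w x..graphParam ρ w y,
        (inner ℝ (l (graphTime ρ w s)) (deriv (graphState ρ w) s) -
          inner ℝ (l x) (deriv (graphState ρ w) s))| ≤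
      (variationFrom l y - variationFrom l x) * ρ⁻¹ * |graphParam ρ w y - graphParam ρ w x| := by
    rw [← Real.norm_eq_abs]
    refine intervalIntegral.norm_integral_le_of_norm_le_const fun s hs => ?_
    rw [uIoc_of_le hmono] at hs
    have hx : x ≤ graphTime ρ w s := by
      rw [← graphTime_graphParam hρ hw x]; exact graphTime_monotone hρ hw hs.1.le
    have hy : graphTime ρ w s ≤ y := by
      conv_rhs => rw [← graphTime_graphParam hρ hw y]
      exact graphTime_monotone hρ hw hs.2
    rw [← inner_sub_left]
    refine (norm_inner_le_norm _ _).trans ?_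
    refine mul_le_mul ?_ (norm_deriv_graphState_le hρ hw s) (norm_nonneg _) hV0
    rw [← dist_eq_norm, dist_comm]
    have := variationFrom_monotone hl hy
    linarith [dist_le_variationFrom_sub hl hx]
  rw [h2]
  refine (abs_add_le _ _).trans ?_
  rw [abs_of_nonneg (sub_nonneg.2 hmono)] at h4
  have h5 : (variationFrom l y - variationFrom l x) * ρ⁻¹ * (graphParam ρ w y - graphParam ρ w x)
      ≤ (variationFrom l y - variationFrom l x) * ρ⁻¹ * ε :=
    mul_le_mul_of_nonneg_left hε' (mul_nonneg hV0 (inv_nonneg.2 hρ.le))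
  linarith

/-- Integration by parts for the Kurzweil integral `∫ w dl` over an interval on which `w` is
continuous: `∫ l dw` becomes a Lebesgue integral along the completed graph of `w`. -/
theorem HasKurzweilIntegral.eq_sub_integral (hρ : 0 < ρ) (hw : BoundedVariationOn w univ)
    (hl : BoundedVariationOn l univ) {t₁ t₂ J : ℝ} (ht : t₁ ≤ t₂)
    (hc : ∀ t ∈ Icc t₁ t₂, ContinuousAt w t) (hJ : HasKurzweilIntegral w l t₁ t₂ J) :
    J = inner ℝ (w t₂) (l t₂) - inner ℝ (w t₁) (l t₁)
      - ∫ s in graphParam ρ w t₁..graphParam ρ w t₂,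
          inner ℝ (l (graphTime ρ w s)) (deriv (graphState ρ w) s) := by
  set g : ℝ → ℝ := fun s => inner ℝ (l (graphTime ρ w s)) (deriv (graphState ρ w) s)
  set V := variationFrom l t₂ - variationFrom l t₁
  have hV : 0 ≤ V := sub_nonneg.2 (variationFrom_monotone hl ht)
  -- compare both sides along a partition that is fine for the gauge of the Kurzweil integral and
  -- for the moduli of continuity of `w` and of the parametrization
  have key : ∀ ε > 0, |J - (inner ℝ (w t₂) (l t₂) - inner ℝ (w t₁) (l t₁)
      - ∫ s in graphParam ρ w t₁..graphParam ρ w t₂, g s)| ≤ ε * (1 + (1 + ρ⁻¹) * V) := by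
    intro ε hε
    obtain ⟨δ, hδ, H⟩ := hJ ε hε
    have hu1 := isCompact_Icc.uniformContinuousOn_of_continuous
      (fun t h => (hc t h).continuousWithinAt : ContinuousOn w (Icc t₁ t₂))
    have hu2 := isCompact_Icc.uniformContinuousOn_of_continuous
      (fun t h => (graphParam_continuousAt (ρ := ρ) hw (hc t h)).continuousWithinAt :
        ContinuousOn (graphParam ρ w) (Icc t₁ t₂))
    obtain ⟨η₁, hη₁, h1⟩ := Metric.uniformContinuousOn_iff_le.1 hu1 ε hε
    obtain ⟨η₂, hη₂, h2⟩ := Metric.uniformContinuousOn_iff_le.1 hu2 ε hε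
    obtain ⟨n, x, τ, hx, hτ⟩ := hasFinePartition (δ := fun t => min (δ t) (min η₁ η₂ / 2)) ht
      fun t h => lt_min (hδ t h) (by positivity)
    have hfine := H n x τ hx fun i hi => ⟨(hτ i hi).1, (hτ i hi).2.trans fun v hv =>
      ⟨by linarith [hv.1, min_le_left (δ (τ i)) (min η₁ η₂ / 2)],
        by linarith [hv.2, min_le_left (δ (τ i)) (min η₁ η₂ / 2)]⟩⟩
    let G : ℕ → ℝ := fun i => inner ℝ (w (x i)) (l (x i))
    have hint : ∀ p q, IntervalIntegrable g volume p q := fun p q =>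
      intervalIntegrable_inner_load hρ hw hl p q
    have htel : inner ℝ (w t₂) (l t₂) - inner ℝ (w t₁) (l t₁)
        - ∫ s in graphParam ρ w t₁..graphParam ρ w t₂, g s =
        ∑ i ∈ Finset.range n, (inner ℝ (w (x (i + 1))) (l (x (i + 1))) - inner ℝ (w (x i)) (l (x i))
          - ∫ s in graphParam ρ w (x i)..graphParam ρ w (x (i + 1)), g s) := by
      rw [Finset.sum_sub_distrib, Finset.sum_range_sub G,
        intervalIntegral.sum_integral_adjacent_intervals
          (a := fun i => graphParam ρ w (x i)) fun i _ => hint _ _]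
      simp only [G, hx.1, hx.2.1]
    have hsum : |∑ i ∈ Finset.range n, inner ℝ (w (τ i)) (l (x (i + 1)) - l (x i)) -
        (inner ℝ (w t₂) (l t₂) - inner ℝ (w t₁) (l t₁)
          - ∫ s in graphParam ρ w t₁..graphParam ρ w t₂, g s)| ≤ (ε + ρ⁻¹ * ε) * V := by
      rw [htel, ← Finset.sum_sub_distrib]
      refine (Finset.abs_sum_le_sum_abs _ _).trans ?_
      have hVs : V = ∑ i ∈ Finset.range n,
          (variationFrom l (x (i + 1)) - variationFrom l (x i)) := by
        rw [Finset.sum_range_sub fun i => variationFrom l (x i), hx.1, hx.2.1]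
      rw [hVs, Finset.mul_sum]
      refine Finset.sum_le_sum fun i hi => ?_
      have hi := Finset.mem_range.1 hi
      have hxi := hx.mem_Icc hi.le
      have hxi' := hx.mem_Icc hi
      have hlt := (hx.2.2 i hi).le
      have hτi := (hτ i hi).1
      have hl1 := (hτ i hi).2 (left_mem_Icc.2 hlt)
      have hl2 := (hτ i hi).2 (right_mem_Icc.2 hlt)
      have hm := min_le_right (δ (τ i)) (min η₁ η₂ / 2)
      have hm1 := min_le_left η₁ η₂
      have hm2 := min_le_right η₁ η₂
      have hlen : x (i + 1) - x i ≤ min η₁ η₂ := by linarith [hl1.1, hl2.2]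
      refine abs_inner_sub_le hρ hw hl hlt ?_ ?_
      · refine h1 _ ⟨hxi.1.trans hτi.1, hτi.2.trans hxi'.2⟩ _ hxi' ?_
        rw [dist_comm, Real.dist_eq, abs_of_nonneg (by linarith [hτi.2])]
        linarith [hτi.1]
      · refine (le_abs_self _).trans (h2 _ hxi' _ hxi ?_)
        rw [Real.dist_eq, abs_of_nonneg (by linarith)]
        linarith
    have h3 := abs_sub_le J (∑ i ∈ Finset.range n, inner ℝ (w (τ i)) (l (x (i + 1)) - l (x i)))
      (inner ℝ (w t₂) (l t₂) - inner ℝ (w t₁) (l t₁)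
        - ∫ s in graphParam ρ w t₁..graphParam ρ w t₂, g s)
    rw [abs_sub_comm J (∑ i ∈ Finset.range n, _)] at h3
    linarith
  have hC : 0 < 1 + (1 + ρ⁻¹) * V := by positivity
  rw [← sub_eq_zero, ← abs_eq_zero]
  refine le_antisymm (le_of_forall_pos_le_add fun ε hε => ?_) (abs_nonneg _)
  have := key (ε / (1 + (1 + ρ⁻¹) * V)) (by positivity)
  rwa [div_mul_cancel₀ _ hC.ne', ← zero_add ε] at this

end Kurzweil

/-! ### The energy and the symmetric dissipation -/

section Energy

variable {d : ℕ}

/-- The gradient `A v + DF(v)` of the stored energy. -/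
def storedGrad (A : Matrix (Fin d) (Fin d) ℝ) (F : Vec d → ℝ) (v : Vec d) : Vec d :=
  mulVec A v + gradient F v

variable {A : Matrix (Fin d) (Fin d) ℝ} {F : Vec d → ℝ}

theorem contDiff_mulVec {n : WithTop ℕ∞} : ContDiff ℝ n (mulVec A) :=
  (LinearMap.toContinuousLinearMap (Matrix.toEuclideanLin A)).contDiff

theorem IsNonlinearity.contDiff_storedGrad (hF : IsNonlinearity F) :
    ContDiff ℝ 1 (storedGrad A F) := by
  refine contDiff_mulVec.add ?_
  exact (InnerProductSpace.toDual ℝ (Vec d)).symm.toContinuousLinearEquiv.contDiff.comp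
    (hF.smooth.fderiv_right (m := 1) (by norm_num))

theorem IsNonlinearity.contDiff_storedEnergy (hF : IsNonlinearity F) :
    ContDiff ℝ 1 (storedEnergy A F) := by
  have h1 : ContDiff ℝ 1 fun v => (inner ℝ (mulVec A v) v : ℝ) :=
    contDiff_mulVec.inner ℝ contDiff_id
  exact (contDiff_const.mul h1).add (hF.smooth.of_le (by norm_num))

theorem hasGradientAt_storedEnergy (hA : A.IsHermitian) (hF : IsNonlinearity F) (v : Vec d) :
    HasGradientAt (storedEnergy A F) (storedGrad A F v) v := by
  have hsym := Matrix.isSymmetric_toEuclideanLin_iff.2 hA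
  have hL : HasFDerivAt (mulVec A) (LinearMap.toContinuousLinearMap (Matrix.toEuclideanLin A)) v :=
    (LinearMap.toContinuousLinearMap (Matrix.toEuclideanLin A)).hasFDerivAt
  have hFd := (hF.smooth.differentiable (by norm_num) v).hasGradientAt
  rw [hasGradientAt_iff_hasFDerivAt] at hFd ⊢
  have h1 := ((hL.inner ℝ (hasFDerivAt_id v)).const_mul (1 / 2)).add hFd
  convert! h1 using 1
  ext y
  have h2 : inner ℝ (mulVec A y) v = inner ℝ (mulVec A v) y := by
    rw [real_inner_comm]; exact (hsym v y).symm
  simp [storedGrad, fderivInnerCLM_apply]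
  rw [show (Matrix.toEuclideanLin A) y = mulVec A y from rfl, h2]
  ring

theorem gradient_energy (hA : A.IsHermitian) (hF : IsNonlinearity F) (l : ℝ → Vec d) (t : ℝ)
    (v : Vec d) : gradient (energy A F l t) v = storedGrad A F v - l t := by
  have h1 := hasGradientAt_storedEnergy hA hF v
  refine HasGradientAt.gradient ?_
  rw [hasGradientAt_iff_hasFDerivAt] at h1 ⊢
  have h2 := h1.sub (innerSL ℝ (l t)).hasFDerivAt
  convert! h2 using 1
  ext y
  simp

/-- The chain rule for the stored energy along a Lipschitz curve, in integrated form. -/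
theorem integral_inner_storedGrad (hA : A.IsHermitian) (hF : IsNonlinearity F) {u : ℝ → Vec d}
    {K : ℝ≥0} (hu : LipschitzWith K u) (a b : ℝ) :
    ∫ s in a..b, inner ℝ (storedGrad A F (u s)) (deriv u s) =
      storedEnergy A F (u b) - storedEnergy A F (u a) := by
  obtain ⟨C, hC⟩ := (isCompact_uIcc (a := a) (b := b)).exists_bound_of_continuousOn
    hu.continuous.continuousOn
  obtain ⟨L, hL⟩ := (hF.contDiff_storedEnergy (A := A)).contDiffOn.exists_lipschitzOnWith
    (by decide) (convex_closedBall (0 : Vec d) C) (isCompact_closedBall _ _)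
  have hac : AbsolutelyContinuousOnInterval (storedEnergy A F ∘ u) a b :=
    (hL.comp (hu.lipschitzOnWith (s := uIcc a b)) fun s hs =>
      mem_closedBall_zero_iff.2 (hC s hs)).absolutelyContinuousOnInterval
  refine (intervalIntegral.integral_congr_ae ?_).trans hac.integral_deriv_eq_sub
  filter_upwards [hu.ae_differentiableAt_real] with s hs _
  have := (hasGradientAt_iff_hasFDerivAt.1
    (hasGradientAt_storedEnergy hA hF (u s))).comp_hasDerivAt s hs.hasDerivAt
  rw [this.deriv]
  simp

theorem intervalIntegrable_inner_storedGrad (hF : IsNonlinearity F) {u : ℝ → Vec d}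
    {K : ℝ≥0} (hu : LipschitzWith K u) (a b : ℝ) :
    IntervalIntegrable (fun s => inner ℝ (storedGrad A F (u s)) (deriv u s)) volume a b := by
  have hc : Continuous fun s => storedGrad A F (u s) :=
    hF.contDiff_storedGrad.continuous.comp hu.continuous
  have hb : IntervalIntegrable (fun s => ‖storedGrad A F (u s)‖ * K) volume a b :=
    (hc.norm.mul continuous_const).intervalIntegrable a b
  refine hb.mono_fun
    (hc.aestronglyMeasurable.inner (deriv_aestronglyMeasurable _)).restrict
    (Eventually.of_forall fun s => ?_)
  refine (norm_inner_le_norm _ _).trans (le_trans ?_ (le_abs_self _))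
  exact mul_le_mul_of_nonneg_left (norm_deriv_le_of_lipschitz hu) (norm_nonneg _)

variable {R : Vec d → ℝ} {ρ : ℝ}

/-- A dissipation that depends on the norm only is a positive multiple of the norm. -/
theorem IsDissipation.exists_eq_mul_norm (hR : IsDissipation R)
    (hsymm : ∀ z₁ z₂ : Vec d, R z₁ = R z₂ ↔ ‖z₁‖ = ‖z₂‖) :
    ∃ ρ > 0, ∀ v, R v = ρ * ‖v‖ := by
  obtain ⟨c, C, hc, -, hb⟩ := hR.bounds
  have h0 : R 0 = 0 := by
    have := hb 0
    simp only [norm_zero, mul_zero] at this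
    exact le_antisymm this.2 this.1
  by_cases h : ∃ e : Vec d, e ≠ 0
  · obtain ⟨e, he⟩ := h
    have hen : 0 < ‖e‖ := norm_pos_iff.2 he
    refine ⟨R e / ‖e‖, div_pos (lt_of_lt_of_le (by positivity) (hb e).1) hen, fun v => ?_⟩
    rcases eq_or_ne v 0 with rfl | hv
    · simp [h0]
    · have hvn : 0 < ‖v‖ := norm_pos_iff.2 hv
      have h1 : R v = R ((‖v‖ / ‖e‖) • e) := (hsymm _ _).2 (by
        rw [norm_smul, Real.norm_of_nonneg (by positivity), div_mul_cancel₀ _ hen.ne'])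
      rw [h1, hR.homogeneous _ _ (by positivity)]
      ring
  · push Not at h
    exact ⟨1, one_pos, fun v => by rw [h v, h0]; simp⟩

theorem subdiff_zero_eq_closedBall (hρ : 0 < ρ) (hR : ∀ v, R v = ρ * ‖v‖) :
    subdiff R 0 = Metric.closedBall 0 ρ := by
  ext xi
  simp only [subdiff, mem_ofPred_eq, hR, norm_zero, mul_zero, zero_add, sub_zero,
    mem_closedBall_zero_iff]
  constructor
  · intro h
    have := h xi
    rw [real_inner_self_eq_norm_mul_norm] at this
    by_contra! h'
    have := le_of_mul_le_mul_right this (hρ.trans h')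
    linarith
  · intro h v
    exact (real_inner_le_norm _ _).trans (mul_le_mul_of_nonneg_right h (norm_nonneg _))

theorem forceDist_eq_zero (hA : A.IsHermitian) (hF : IsNonlinearity F) (hρ : 0 < ρ)
    (hR : ∀ v, R v = ρ * ‖v‖) {l z : ℝ → Vec d} {s : ℝ}
    (h : ‖storedGrad A F (z s) - l s‖ ≤ ρ) : forceDist A F R l z s = 0 := by
  rw [forceDist, subdiff_zero_eq_closedBall hρ hR, gradient_energy hA hF]
  exact Metric.infDist_zero_of_mem (by simpa [norm_sub_rev] using h)

end Energy

/-! ### The energy balance on intervals of continuity -/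

section Balance

variable {d : ℕ} {A : Matrix (Fin d) (Fin d) ℝ} {F R : Vec d → ℝ} {ρ T : ℝ} {w l : ℝ → Vec d}

/-- Local stability holds at every common point of continuity of the state and the load. -/
theorem norm_storedGrad_sub_le_of_continuousAt (hF : IsNonlinearity F)
    (hstab : ∀ᵐ t, t ∈ Ioo 0 T → ‖storedGrad A F (w t) - l t‖ ≤ ρ) {t : ℝ} (ht : t ∈ Ioo 0 T)
    (hwt : ContinuousAt w t) (hlt : ContinuousAt l t) : ‖storedGrad A F (w t) - l t‖ ≤ ρ := by
  by_contra! h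
  have hc : ContinuousAt (fun t => ‖storedGrad A F (w t) - l t‖) t :=
    ((hF.contDiff_storedGrad.continuous.continuousAt.comp hwt).sub hlt).norm
  have h1 : ∀ᶠ t' in 𝓝 t, t' ∈ Ioo 0 T ∧ ρ < ‖storedGrad A F (w t') - l t'‖ :=
    (isOpen_Ioo.eventually_mem ht).and (hc.eventually (lt_mem_nhds h))
  obtain ⟨t', h2, h3⟩ := ((Measure.dense_of_ae hstab).inter_nhds_nonempty h1)
  exact absurd (h2 h3.1) (not_le.2 h3.2)

theorem graphParam_eq_of_continuousAt {t : ℝ} (ht : ContinuousAt w t) :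
    graphParamLeft ρ w t = graphParam ρ w t ∧ graphParamRight ρ w t = graphParam ρ w t := by
  rw [graphParamLeft, graphParamRight,
    leftLim_eq_of_tendsto (ht.tendsto.mono_left nhdsWithin_le_nhds),
    rightLim_eq_of_tendsto (ht.tendsto.mono_left nhdsWithin_le_nhds), dist_self, mul_zero,
    sub_zero, add_zero]
  exact ⟨rfl, rfl⟩

theorem eq_graphParam_graphTime (hρ : 0 < ρ) (hw : BoundedVariationOn w univ) {s : ℝ}
    (hc : ContinuousAt w (graphTime ρ w s)) : s = graphParam ρ w (graphTime ρ w s) := by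
  have h := graphTime_spec hρ hw s
  rw [(graphParam_eq_of_continuousAt hc).1, (graphParam_eq_of_continuousAt hc).2] at h
  exact le_antisymm h.2 h.1

/-- The state at a parameter off the jumps is stable, unless the load jumps there; this excludes
only countably many parameters. -/
theorem ae_norm_storedGrad_graphState_sub_le (hF : IsNonlinearity F) (hρ : 0 < ρ)
    (hw : BoundedVariationOn w univ) (hl : BoundedVariationOn l univ)
    (hstab : ∀ᵐ t, t ∈ Ioo 0 T → ‖storedGrad A F (w t) - l t‖ ≤ ρ) :
    ∀ᵐ s, graphTime ρ w s ∈ Ioo 0 T → ContinuousAt w (graphTime ρ w s) →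
      ‖storedGrad A F (graphState ρ w s) - l (graphTime ρ w s)‖ ≤ ρ := by
  have hD := ((countable_not_continuousAt hl).image (graphParam ρ w)).ae_notMem volume
  filter_upwards [hD] with s hs hsT hws
  have hsb := eq_graphParam_graphTime hρ hw hws
  have hlt : ContinuousAt l (graphTime ρ w s) := by
    by_contra h
    exact hs ⟨_, h, hsb.symm⟩
  have := norm_storedGrad_sub_le_of_continuousAt hF hstab hsT hws hlt
  rwa [← graphState_graphParam hρ hw (graphTime ρ w s), ← hsb] at this

/-- On an interval without jumps the energy balance holds at almost every parameter: the rate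
below is nonnegative by local stability, and its integral is nonpositive by the energy
inequality. -/
theorem ae_energy_rate_eq_zero (hA : A.IsHermitian) (hF : IsNonlinearity F) (hρ : 0 < ρ)
    (hR : ∀ v, R v = ρ * ‖v‖) (hw : BoundedVariationOn w univ) (hl : BoundedVariationOn l univ)
    (hstab : ∀ᵐ t, t ∈ Ioo 0 T → ‖storedGrad A F (w t) - l t‖ ≤ ρ)
    {t₁ t₂ J : ℝ} (h₁ : 0 < t₁) (h₁₂ : t₁ ≤ t₂) (h₂ : t₂ < T)
    (hc : ∀ t ∈ Icc t₁ t₂, ContinuousAt w t) (hJ : HasKurzweilIntegral w l t₁ t₂ J)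
    (henergy : energy A F l t₂ (w t₂) + diss R w t₁ t₂ ≤ energy A F l t₁ (w t₁) - J) :
    ∀ᵐ s, s ∈ Ioc (graphParam ρ w t₁) (graphParam ρ w t₂) →
      inner ℝ (storedGrad A F (graphState ρ w s)) (deriv (graphState ρ w) s)
        + ρ * ‖deriv (graphState ρ w) s‖
        - inner ℝ (l (graphTime ρ w s)) (deriv (graphState ρ w) s) = 0 := by
  have hlip := graphState_lipschitz hρ hw
  have hmono := (graphParam_strictMono hρ hw).monotone h₁₂
  have hi1 := intervalIntegrable_inner_storedGrad (A := A) hF hlip (graphParam ρ w t₁)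
    (graphParam ρ w t₂)
  have hi2 := (intervalIntegrable_deriv_of_lipschitz hlip (graphParam ρ w t₁)
    (graphParam ρ w t₂)).norm.const_mul ρ
  have hi3 := intervalIntegrable_inner_load hρ hw hl (graphParam ρ w t₁) (graphParam ρ w t₂)
  refine ae_eq_zero_of_integral_nonpos hmono ((hi1.add hi2).sub hi3) ?_ ?_
  · filter_upwards [ae_norm_storedGrad_graphState_sub_le hF hρ hw hl hstab] with s hs hsI
    have hx : t₁ ≤ graphTime ρ w s := by
      rw [← graphTime_graphParam hρ hw t₁]; exact graphTime_monotone hρ hw hsI.1.le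
    have hy : graphTime ρ w s ≤ t₂ := by
      conv_rhs => rw [← graphTime_graphParam hρ hw t₂]
      exact graphTime_monotone hρ hw hsI.2
    have h3 := hs ⟨h₁.trans_le hx, hy.trans_lt h₂⟩ (hc _ ⟨hx, hy⟩)
    have h4 := (abs_le.1 (abs_real_inner_le_norm
      (storedGrad A F (graphState ρ w s) - l (graphTime ρ w s)) (deriv (graphState ρ w) s))).1
    rw [inner_sub_left] at h4
    have h5 := mul_le_mul_of_nonneg_right h3 (norm_nonneg (deriv (graphState ρ w) s))
    linarith
  · rw [intervalIntegral.integral_sub (hi1.add hi2) hi3, intervalIntegral.integral_add hi1 hi2,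
      integral_inner_storedGrad hA hF hlip, integral_mul_norm_deriv_graphState hρ hw h₁₂,
      graphState_graphParam hρ hw, graphState_graphParam hρ hw]
    have h3 := HasKurzweilIntegral.eq_sub_integral hρ hw hl h₁₂ hc hJ
    have h4 := mul_variationFrom_sub_le_diss hρ hR hw h₁₂
    simp only [energy] at henergy
    rw [real_inner_comm, real_inner_comm (l t₁)] at h3
    linarith

end Balance

/-! ### The load along the completed graph -/

section Load

variable {d : ℕ} {A : Matrix (Fin d) (Fin d) ℝ} {F R : Vec d → ℝ} {ρ T : ℝ} {w l : ℝ → Vec d}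

/-- The open parameter intervals on which the completed graph runs through the jumps of `w`. -/
def jumpSegments (ρ : ℝ) (w : ℝ → Vec d) : Set ℝ :=
  ⋃ t, Ioo (graphParamLeft ρ w t) (graphParam ρ w t) ∪
    Ioo (graphParam ρ w t) (graphParamRight ρ w t)

theorem left_subset_jumpSegments (t : ℝ) :
    Ioo (graphParamLeft ρ w t) (graphParam ρ w t) ⊆ jumpSegments ρ w :=
  fun _ hs => mem_iUnion.2 ⟨t, Or.inl hs⟩

theorem right_subset_jumpSegments (t : ℝ) :
    Ioo (graphParam ρ w t) (graphParamRight ρ w t) ⊆ jumpSegments ρ w :=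
  fun _ hs => mem_iUnion.2 ⟨t, Or.inr hs⟩

/-- The parameters at which the segments filling in the jump at `t` begin and end. -/
def jumpNodes (ρ : ℝ) (w : ℝ → Vec d) (t : ℝ) : Set ℝ :=
  {graphParamLeft ρ w t, graphParam ρ w t, graphParamRight ρ w t}

theorem finite_jumpNodes (t : ℝ) : (jumpNodes ρ w t).Finite := by
  simp [jumpNodes]

open Classical in
/-- The load along the completed graph of `w`: the given load off the jumps, and inside a jump the
load that drives the state along the segment. -/
def graphLoad (A : Matrix (Fin d) (Fin d) ℝ) (F : Vec d → ℝ) (ρ : ℝ) (w l : ℝ → Vec d) (s : ℝ) :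
    Vec d :=
  if s ∈ jumpSegments ρ w then
    storedGrad A F (graphState ρ w s) +
      (1 / ‖deriv (graphState ρ w) s‖ ^ 2) • deriv (graphState ρ w) s
  else l (graphTime ρ w s)

theorem hasDerivAt_of_eq_segment {u : ℝ → Vec d} {p q : Vec d} {α β s : ℝ}
    (hu : ∀ s ∈ Icc α β, u s = p + ((s - α) / (β - α)) • (q - p)) (hs : s ∈ Ioo α β) :
    HasDerivAt u ((1 / (β - α)) • (q - p)) s := by
  have h1 : HasDerivAt (fun s => p + ((s - α) / (β - α)) • (q - p)) ((1 / (β - α)) • (q - p)) s :=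
    ((((hasDerivAt_id s).sub_const α).div_const (β - α)).smul_const (q - p)).const_add p
  refine h1.congr_of_eventuallyEq ?_
  filter_upwards [Icc_mem_nhds hs.1 hs.2] with y hy using hu y hy

theorem norm_segment_velocity (hρ : 0 < ρ) {p q : Vec d} {α β : ℝ} (hL : β - α = ρ * ‖q - p‖)
    (hαβ : α < β) : ‖(1 / (β - α)) • (q - p)‖ = ρ⁻¹ := by
  have h1 : 0 < β - α := sub_pos.2 hαβ
  have h2 : ‖q - p‖ ≠ 0 := fun h => by rw [h, mul_zero] at hL; exact h1.ne' hL
  rw [norm_smul, Real.norm_of_nonneg (by positivity), hL]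
  field_simp

/-- Every parameter inside a jump lies in one of the segments, which the state runs through with
constant velocity of norm `1 / ρ`. -/
theorem exists_segment (hρ : 0 < ρ) (hw : BoundedVariationOn w univ) {s : ℝ}
    (hs : s ∈ jumpSegments ρ w) :
    ∃ t α β : ℝ, ∃ v : Vec d, ¬ ContinuousAt w t ∧ α ∈ jumpNodes ρ w t ∧ β ∈ jumpNodes ρ w t ∧
      s ∈ Ioo α β ∧ Ioo α β ⊆ jumpSegments ρ w ∧ ‖v‖ = ρ⁻¹ ∧
      ∀ y ∈ Ioo α β, graphTime ρ w y = t ∧ deriv (graphState ρ w) y = v := by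
  obtain ⟨t, ht⟩ := mem_iUnion.1 hs
  have hle := graphParamLeft_le (w := w) hρ t
  have hri := le_graphParamRight (w := w) hρ t
  have hn : ¬ ContinuousAt w t := fun h => by
    obtain ⟨h1, h2⟩ := graphParam_eq_of_continuousAt (ρ := ρ) h
    rw [h1, h2] at ht
    simp at ht
  rcases ht with ht | ht
  · refine ⟨t, _, _, _, hn, Or.inl rfl, Or.inr (Or.inl rfl), ht,
      left_subset_jumpSegments t,
      norm_segment_velocity hρ (graphParam_sub_left t) (ht.1.trans ht.2), fun y hy => ⟨?_, ?_⟩⟩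
    · exact (graphTime_eq_iff hρ hw).2 ⟨hy.1.le, hy.2.le.trans hri⟩
    · exact (hasDerivAt_of_eq_segment (fun x hx => graphState_of_mem_left hρ hw hx) hy).deriv
  · refine ⟨t, _, _, _, hn, Or.inr (Or.inl rfl), Or.inr (Or.inr rfl), ht,
      right_subset_jumpSegments t,
      norm_segment_velocity hρ (graphParam_right_sub t) (ht.1.trans ht.2), fun y hy => ⟨?_, ?_⟩⟩
    · exact (graphTime_eq_iff hρ hw).2 ⟨hle.trans hy.1.le, hy.2.le⟩
    · exact (hasDerivAt_of_eq_segment (fun x hx => graphState_of_mem_right hρ hw hx) hy).deriv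

theorem norm_deriv_of_mem_jumpSegments (hρ : 0 < ρ) (hw : BoundedVariationOn w univ) {s : ℝ}
    (hs : s ∈ jumpSegments ρ w) : ‖deriv (graphState ρ w) s‖ = ρ⁻¹ := by
  obtain ⟨t, α, β, v, -, -, -, hsI, -, hv, H⟩ := exists_segment hρ hw hs
  rw [(H s hsI).2, hv]

/-- Inside a jump the driving force has distance `0` to the stable set: it lies on its boundary. -/
theorem norm_storedGrad_sub_graphLoad (hρ : 0 < ρ) (hw : BoundedVariationOn w univ) {s : ℝ}
    (hs : s ∈ jumpSegments ρ w) :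
    ‖storedGrad A F (graphState ρ w s) - graphLoad A F ρ w l s‖ = ρ := by
  rw [graphLoad, if_pos hs, sub_add_cancel_left, norm_neg, norm_smul,
    norm_deriv_of_mem_jumpSegments hρ hw hs, Real.norm_of_nonneg (by positivity)]
  field_simp

theorem energy_rate_of_mem_jumpSegments (hρ : 0 < ρ) (hw : BoundedVariationOn w univ) {s : ℝ}
    (hs : s ∈ jumpSegments ρ w) :
    inner ℝ (storedGrad A F (graphState ρ w s)) (deriv (graphState ρ w) s)
      + ρ * ‖deriv (graphState ρ w) s‖
      - inner ℝ (graphLoad A F ρ w l s) (deriv (graphState ρ w) s) = 0 := by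
  rw [graphLoad, if_pos hs, inner_add_left, real_inner_smul_left, real_inner_self_eq_norm_sq,
    norm_deriv_of_mem_jumpSegments hρ hw hs]
  field_simp
  ring

theorem isLinearJump_of_segment (hρ : 0 < ρ) (hR : ∀ v, R v = ρ * ‖v‖)
    (hw : BoundedVariationOn w univ) {α β : ℝ} {p q : Vec d} (hL : β - α = ρ * ‖q - p‖)
    (hα : graphState ρ w α = p) (hβ : graphState ρ w β = q)
    (hseg : ∀ s ∈ Icc α β, graphState ρ w s = p + ((s - α) / (β - α)) • (q - p))
    (hsub : Ioo α β ⊆ jumpSegments ρ w) :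
    IsLinearJump A F R (graphState ρ w) (graphLoad A F ρ w l) α β p q := by
  refine ⟨by rw [hL, hR], hα, hβ, hseg, fun s hs => ⟨?_, ?_, ?_⟩⟩
  · exact (hasDerivAt_of_eq_segment hseg hs).differentiableAt
  · rw [← norm_ne_zero_iff, norm_deriv_of_mem_jumpSegments hρ hw (hsub hs)]
    exact inv_ne_zero hρ.ne'
  · rw [graphLoad, if_pos (hsub hs), storedGrad]

/-- The load along the completed graph of a function with finitely many jumps has bounded
variation: its increments are dominated by those of a monotone function which is the sum of a
linear part (for the motion along the segments), the variation of the given load, and the number of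
segment end points passed. -/
theorem boundedVariationOn_graphLoad (hF : IsNonlinearity F) (hρ : 0 < ρ)
    (hw : BoundedVariationOn w univ) (hl : BoundedVariationOn l univ)
    (hfin : {t | ¬ ContinuousAt w t}.Finite) (S : ℝ) :
    BoundedVariationOn (graphLoad A F ρ w l) (Icc 0 S) := by
  classical
  have hlip := graphState_lipschitz hρ hw
  obtain ⟨C, hC⟩ := (isCompact_Icc (a := 0) (b := S)).exists_bound_of_continuousOn
    hlip.continuous.continuousOn
  obtain ⟨L, hL⟩ := (hF.contDiff_storedGrad (A := A)).contDiffOn.exists_lipschitzOnWith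
    (by decide) (convex_closedBall (0 : Vec d) C) (isCompact_closedBall _ _)
  have hgl := hL.comp (hlip.lipschitzOnWith (s := Icc 0 S)) fun s hs =>
      mem_closedBall_zero_iff.2 (hC s hs)
  set L' := L * Real.toNNReal ρ⁻¹
  obtain ⟨G, hG⟩ := (isCompact_Icc (a := 0) (b := S)).exists_bound_of_continuousOn
    hgl.continuousOn
  obtain ⟨B, hB⟩ := exists_norm_le_of_boundedVariationOn hl
  have hB0 := (norm_nonneg _).trans (hB 0)
  obtain ⟨P, hP⟩ : ∃ P : Finset ℝ, ∀ t, ¬ ContinuousAt w t → jumpNodes ρ w t ⊆ P := by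
    have hPf : (⋃ t ∈ {t | ¬ ContinuousAt w t}, jumpNodes ρ w t).Finite :=
      hfin.biUnion fun t _ => finite_jumpNodes t
    refine ⟨hPf.toFinset, fun t ht => ?_⟩
    rw [Finite.coe_toFinset]
    exact subset_biUnion_of_mem (u := jumpNodes ρ w) (mem_ofPred_eq ▸ ht)
  set M := max G 0 + ρ + B
  have hM : ∀ s ∈ Icc 0 S, ‖graphLoad A F ρ w l s‖ ≤ M := by
    intro s hs
    have h1 := hG s hs
    have h2 := le_max_left G 0
    have h3 := le_max_right G 0
    by_cases h : s ∈ jumpSegments ρ w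
    · have h4 := norm_storedGrad_sub_graphLoad (A := A) (F := F) (l := l) hρ hw h
      have h5 := norm_le_norm_add_norm_sub (storedGrad A F (graphState ρ w s))
        (graphLoad A F ρ w l s)
      simp only [comp_apply] at h1
      simp only [M]
      linarith
    · rw [graphLoad, if_neg h]
      have := hB (graphTime ρ w s)
      simp only [M]
      linarith
  set N : ℝ → ℝ := fun s => ((P.filter (· < s)).card + (P.filter (· ≤ s)).card : ℕ)
  have hNmono : Monotone N := fun x y hxy => by
    simp only [N]
    gcongr
  have hNlt : ∀ {x y p : ℝ}, x < y → p ∈ P → p ∈ Icc x y → N x + 1 ≤ N y := by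
    intro x y p hxy hp hpI
    have h1 : (P.filter (· < x)).card ≤ (P.filter (· < y)).card :=
      Finset.card_le_card (Finset.monotone_filter_right _ fun _ _ h => lt_trans h hxy)
    have h2 : (P.filter (· ≤ x)).card ≤ (P.filter (· ≤ y)).card :=
      Finset.card_le_card (Finset.monotone_filter_right _ fun _ _ h => le_trans h hxy.le)
    have h3 : (P.filter (· < x)).card < (P.filter (· < y)).card ∨
        (P.filter (· ≤ x)).card < (P.filter (· ≤ y)).card := by
      rcases hpI.1.eq_or_lt with rfl | h
      · left
        refine Finset.card_lt_card ((Finset.ssubset_iff_of_subset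
          (Finset.monotone_filter_right _ fun _ _ h => lt_trans h hxy)).2 ⟨x, ?_, ?_⟩)
        · simp [hp, hxy]
        · simp
      · right
        refine Finset.card_lt_card ((Finset.ssubset_iff_of_subset
          (Finset.monotone_filter_right _ fun _ _ h => le_trans h hxy.le)).2 ⟨p, ?_, ?_⟩)
        · simp [hp, hpI.2]
        · simp [h]
    simp only [N]
    exact_mod_cast (by omega : (P.filter (· < x)).card + (P.filter (· ≤ x)).card + 1 ≤
      (P.filter (· < y)).card + (P.filter (· ≤ y)).card)
  set φ : ℝ → ℝ := fun s => L' * s + variationFrom l (graphTime ρ w s) + 2 * M * N s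
  have hM0 : 0 ≤ M := by positivity
  have hVm : Monotone fun s => variationFrom l (graphTime ρ w s) :=
    (variationFrom_monotone hl).comp (graphTime_monotone hρ hw)
  have hφ : Monotone φ := fun x y hxy => by
    have h1 := mul_le_mul_of_nonneg_left hxy L'.2
    have h2 := hVm hxy
    have h3 := mul_le_mul_of_nonneg_left (hNmono hxy) (by positivity : 0 ≤ 2 * M)
    simp only [φ]
    simp only [NNReal.val_eq_coe] at h1 h2
    linarith
  refine boundedVariationOn_of_dominated (hφ.monotoneOn _) (C := |φ 0| + |φ S|) ?_ ?_
  · intro s hs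
    have h1 := hφ hs.1
    have h2 := hφ hs.2
    exact abs_le.2 ⟨by linarith [neg_abs_le (φ 0), abs_nonneg (φ S)],
      by linarith [le_abs_self (φ S), abs_nonneg (φ 0)]⟩
  intro x hx y hy hxy
  have h1 := mul_le_mul_of_nonneg_left hxy L'.2
  have h2 := hVm hxy
  have h3 := mul_le_mul_of_nonneg_left (hNmono hxy) (by positivity : 0 ≤ 2 * M)
  simp only [NNReal.val_eq_coe] at h1 h2
  rcases hxy.eq_or_lt with rfl | hlt
  · simp
  by_cases hp : ∃ p ∈ P, p ∈ Icc x y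
  · -- an end point of a segment is passed: compare with the global bound
    obtain ⟨p, hpP, hpI⟩ := hp
    have h4 := mul_le_mul_of_nonneg_left (hNlt hlt hpP hpI) (by positivity : 0 ≤ 2 * M)
    have h5 := dist_le_norm_add_norm (graphLoad A F ρ w l x) (graphLoad A F ρ w l y)
    have h6 := hM x hx
    have h7 := hM y hy
    simp only [φ]
    linarith
  · push Not at hp
    have hsame : (∃ v : Vec d, x ∈ jumpSegments ρ w ∧ y ∈ jumpSegments ρ w ∧
        deriv (graphState ρ w) x = v ∧ deriv (graphState ρ w) y = v) ∨
        (x ∉ jumpSegments ρ w ∧ y ∉ jumpSegments ρ w) := by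
      by_cases hxs : x ∈ jumpSegments ρ w
      · left
        obtain ⟨t, α, β, v, ht, -, hβ, hxI, hsub, -, H⟩ := exists_segment hρ hw hxs
        have hyI : y ∈ Ioo α β := ⟨hxI.1.trans hlt, not_le.1 fun h =>
          hp β (hP t ht hβ) ⟨hxI.2.le, h⟩⟩
        exact ⟨v, hxs, hsub hyI, (H x hxI).2, (H y hyI).2⟩
      by_cases hys : y ∈ jumpSegments ρ w
      · left
        obtain ⟨t, α, β, v, ht, hα, -, hyI, hsub, -, H⟩ := exists_segment hρ hw hys
        have hxI : x ∈ Ioo α β := ⟨not_le.1 fun h =>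
          hp α (hP t ht hα) ⟨h, hyI.1.le⟩, hlt.trans hyI.2⟩
        exact ⟨v, hsub hxI, hys, (H x hxI).2, (H y hyI).2⟩
      exact Or.inr ⟨hxs, hys⟩
    rcases hsame with ⟨v, hxs, hys, hxv, hyv⟩ | ⟨hxs, hys⟩
    · have h4 := hgl.dist_le_mul x hx y hy
      rw [Real.dist_eq, abs_sub_comm, abs_of_nonneg (sub_nonneg.2 hxy)] at h4
      rw [graphLoad, if_pos hxs, graphLoad, if_pos hys, hxv, hyv, dist_add_right]
      simp only [comp_apply] at h4
      simp only [φ]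
      linarith
    · rw [graphLoad, if_neg hxs, graphLoad, if_neg hys]
      have h4 := dist_le_variationFrom_sub hl (graphTime_monotone hρ hw hxy)
      simp only [φ]
      linarith

end Load

/-! ### Extension to the real line -/

section Extension

variable {d : ℕ} {T : ℝ} {z₀ : Vec d} {z l : ℝ → Vec d}

/-- The state extended to the real line, by the prescribed initial state for negative times and by
its terminal value for times after `T`. The conventions for the one-sided limits at `0` and `T`
become statements about the limits of the extension. -/
def extendState (z₀ : Vec d) (T : ℝ) (z : ℝ → Vec d) (t : ℝ) : Vec d :=
  if t < 0 then z₀ else z (min t T)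

/-- The load extended to the real line by its values at `0` and `T`. -/
def extendLoad (T : ℝ) (l : ℝ → Vec d) (t : ℝ) : Vec d :=
  l (max 0 (min t T))

theorem extendState_of_mem {t : ℝ} (ht : t ∈ Icc 0 T) : extendState z₀ T z t = z t := by
  rw [extendState, if_neg (not_lt.2 ht.1), min_eq_left ht.2]

theorem extendLoad_of_mem {t : ℝ} (ht : t ∈ Icc 0 T) : extendLoad T l t = l t := by
  rw [extendLoad, min_eq_left ht.2, max_eq_right ht.1]

theorem boundedVariationOn_extendLoad (hT : 0 < T) (hl : BoundedVariationOn l (Icc 0 T)) :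
    BoundedVariationOn (extendLoad T l) univ := by
  refine boundedVariationOn_comp_monotone (φ := fun t => max 0 (min t T)) hl ?_ ?_
  · exact (monotone_const.max (monotone_id.min monotone_const)).monotoneOn _
  · exact fun t _ => ⟨le_max_left _ _, max_le hT.le (min_le_right _ _)⟩

theorem boundedVariationOn_extendState (hT : 0 < T) (hz : BoundedVariationOn z (Icc 0 T)) :
    BoundedVariationOn (extendState z₀ T z) univ := by
  have h1 : BoundedVariationOn (extendState z₀ T z) (Ici 0) := by
    have : BoundedVariationOn (z ∘ fun t => min t T) (Ici 0) :=
      boundedVariationOn_comp_monotone hz ((monotone_id.min monotone_const).monotoneOn _)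
        fun t (ht : 0 ≤ t) => ⟨le_min ht hT.le, min_le_right _ _⟩
    rw [BoundedVariationOn] at this ⊢
    rwa [eVariationOn.congr (g := z ∘ fun t => min t T)]
    exact fun t (ht : 0 ≤ t) => by rw [extendState, if_neg (not_lt.2 ht), comp_apply]
  have h2 : BoundedVariationOn (extendState z₀ T z) (Iic 0) := by
    refine boundedVariationOn_of_dominated
      (φ := fun t => if t < 0 then 0 else dist z₀ (z (min 0 T))) (C := dist z₀ (z (min 0 T)))
      ?_ ?_ ?_
    · intro x _ y _ hxy
      dsimp only
      split_ifs with h3 h4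
      · exact le_rfl
      · exact dist_nonneg
      · linarith
      · exact le_rfl
    · intro x _
      split_ifs
      · simp
      · rw [abs_of_nonneg dist_nonneg]
    · intro x hx y hy hxy
      simp only [extendState]
      split_ifs with h3 h4 h4
      · simp
      · rw [le_antisymm hy (not_lt.1 h4), sub_zero]
      · linarith
      · rw [le_antisymm hy (not_lt.1 h4), le_antisymm hx (not_lt.1 h3)]; simp
  rw [BoundedVariationOn, ← Iic_union_Ici (a := (0 : ℝ)),
    eVariationOn.union _ isGreatest_Iic isLeast_Ici]
  exact ENNReal.add_ne_top.2 ⟨h2, h1⟩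

theorem leftLim_extendState (hT : 0 < T) (hz : BoundedVariationOn z (Icc 0 T)) {t : ℝ}
    (ht : t ∈ Icc 0 T) : (extendState z₀ T z).leftLim t = leftState z₀ z t := by
  rw [leftState]
  split_ifs with h
  · obtain rfl : t = 0 := le_antisymm h ht.1
    refine leftLim_eq_of_tendsto (tendsto_const_nhds.congr' ?_)
    filter_upwards [self_mem_nhdsWithin] with s (hs : s < 0)
    rw [extendState, if_pos hs]
  · refine (leftLim_eq_of_tendsto
      (((boundedVariationOn_extendState hT hz).tendsto_leftLim t).congr' ?_)).symm
    filter_upwards [Ioo_mem_nhdsLT (not_le.1 h)] with s hs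
    exact extendState_of_mem ⟨hs.1.le, hs.2.le.trans ht.2⟩

theorem rightLim_extendState (hT : 0 < T) (hz : BoundedVariationOn z (Icc 0 T)) {t : ℝ}
    (ht : t ∈ Icc 0 T) : (extendState z₀ T z).rightLim t = rightState T z t := by
  rw [rightState]
  split_ifs with h
  · obtain rfl : t = T := le_antisymm ht.2 h
    refine rightLim_eq_of_tendsto (tendsto_const_nhds.congr' ?_)
    filter_upwards [self_mem_nhdsWithin] with s (hs : t < s)
    rw [extendState, if_neg (not_lt.2 (hT.trans hs).le), min_eq_right hs.le]
  · refine (rightLim_eq_of_tendsto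
      (((boundedVariationOn_extendState hT hz).tendsto_rightLim t).congr' ?_)).symm
    filter_upwards [Ioo_mem_nhdsGT (not_le.1 h)] with s hs
    exact extendState_of_mem ⟨ht.1.trans hs.1.le, hs.2.le⟩

theorem finite_not_continuousAt_extendState
    (hjumps : {t ∈ Icc 0 T | ¬ ContinuousWithinAt z (Icc 0 T) t}.Finite) :
    {t | ¬ ContinuousAt (extendState z₀ T z) t}.Finite := by
  refine (hjumps.union (toFinite {0, T})).subset fun t ht => ?_
  by_contra h
  simp only [mem_union, mem_insert_iff, mem_singleton_iff, not_or, mem_ofPred_eq] at h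
  obtain ⟨h1, h2, h3⟩ := h
  refine ht ?_
  rcases lt_or_gt_of_ne h2 with h0 | h0
  · refine (continuousAt_const (y := z₀)).congr ?_
    filter_upwards [Iio_mem_nhds h0] with s (hs : s < 0)
    rw [extendState, if_pos hs]
  rcases lt_or_gt_of_ne h3 with h4 | h4
  · have hc : ContinuousAt z t := by
      by_contra hc
      exact h1 ⟨⟨h0.le, h4.le⟩, fun h => hc (h.continuousAt (Icc_mem_nhds h0 h4))⟩
    refine hc.congr ?_
    filter_upwards [Icc_mem_nhds h0 h4] with s hs using (extendState_of_mem hs).symm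
  · refine (continuousAt_const (y := z T)).congr ?_
    filter_upwards [Ioi_mem_nhds h4, Ioi_mem_nhds h0] with s (hs : T < s) (hs' : 0 < s)
    rw [extendState, if_neg (not_lt.2 hs'.le), min_eq_right hs.le]

theorem variationFrom_extendState {t : ℝ} (ht : t ∈ Ico (-1) 0) :
    variationFrom (extendState z₀ T z) t = 0 := by
  rw [variationFrom, variationOnFromTo.eq_of_le _ _ ht.1, univ_inter,
    eVariationOn.constant_on, ENNReal.toReal_zero]
  rintro _ ⟨x, hx, rfl⟩ _ ⟨y, hy, rfl⟩
  rw [extendState, if_pos (hx.2.trans_lt ht.2), extendState, if_pos (hy.2.trans_lt ht.2)]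

theorem graphParam_extendState {ρ t : ℝ} (ht : t ∈ Ico (-1) 0) :
    graphParam ρ (extendState z₀ T z) t = t := by
  rw [graphParam, variationFrom_extendState ht, mul_zero, add_zero]

theorem graphParamLeft_extendState_zero {ρ : ℝ} (hT : 0 < T)
    (hz : BoundedVariationOn z (Icc 0 T)) : graphParamLeft ρ (extendState z₀ T z) 0 = 0 := by
  refine tendsto_nhds_unique
    (tendsto_graphParam_left (boundedVariationOn_extendState hT hz) 0) ?_
  refine (tendsto_id.mono_left nhdsWithin_le_nhds).congr' ?_
  filter_upwards [Ico_mem_nhdsLT (show (-1 : ℝ) < 0 by norm_num)] with t ht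
  exact (graphParam_extendState ht).symm

theorem graphParamRight_extendState_end {ρ : ℝ} (hT : 0 < T)
    (hz : BoundedVariationOn z (Icc 0 T)) :
    graphParamRight ρ (extendState z₀ T z) T = graphParam ρ (extendState z₀ T z) T := by
  have hTm : T ∈ Icc 0 T := right_mem_Icc.2 hT.le
  rw [graphParamRight, rightLim_extendState hT hz hTm, rightState, if_pos le_rfl,
    extendState_of_mem hTm, dist_self, mul_zero, add_zero]

end Extension

/-! ### Almost everywhere properties along the completed graph -/

section AlmostEverywhere

variable {d : ℕ} {A : Matrix (Fin d) (Fin d) ℝ} {F R : Vec d → ℝ} {ρ T : ℝ} {w l : ℝ → Vec d}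

theorem ae_mem_jumpSegments_or (hρ : 0 < ρ) (hw : BoundedVariationOn w univ)
    (hfin : {t | ¬ ContinuousAt w t}.Finite) :
    ∀ᵐ s, s ∈ jumpSegments ρ w ∨ ContinuousAt w (graphTime ρ w s) := by
  have hPf : (⋃ t ∈ {t | ¬ ContinuousAt w t}, jumpNodes ρ w t).Finite :=
    hfin.biUnion fun t _ => finite_jumpNodes t
  filter_upwards [hPf.countable.ae_notMem volume] with s hs
  by_contra! h
  obtain ⟨h1, h2⟩ := h
  have hn : s ∉ jumpNodes ρ w (graphTime ρ w s) := fun h => hs (mem_biUnion h2 h)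
  simp only [jumpNodes, mem_insert_iff, mem_singleton_iff, not_or] at hn
  have hI := graphTime_spec hρ hw s
  rcases lt_or_gt_of_ne hn.2.1 with h3 | h3
  · exact h1 (left_subset_jumpSegments _ ⟨lt_of_le_of_ne hI.1 (Ne.symm hn.1), h3⟩)
  · exact h1 (right_subset_jumpSegments _ ⟨h3, lt_of_le_of_ne hI.2 hn.2.2⟩)

theorem graphTime_mem_Ioo (hρ : 0 < ρ) (hw : BoundedVariationOn w univ) {s : ℝ}
    (hs : s ∈ Ioo (graphParamLeft ρ w 0) (graphParamRight ρ w T))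
    (hc : ContinuousAt w (graphTime ρ w s)) : graphTime ρ w s ∈ Ioo 0 T := by
  obtain ⟨h1, h2⟩ := graphParam_eq_of_continuousAt (ρ := ρ) hc
  have h3 := eq_graphParam_graphTime hρ hw hc
  constructor
  · by_contra! h
    have := graphParamLeft_monotone hρ hw h
    linarith [hs.1]
  · by_contra! h
    have := graphParamRight_monotone hρ hw h
    linarith [hs.2]

theorem ae_forceDist_eq_zero (hA : A.IsHermitian) (hF : IsNonlinearity F) (hρ : 0 < ρ)
    (hR : ∀ v, R v = ρ * ‖v‖) (hw : BoundedVariationOn w univ) (hl : BoundedVariationOn l univ)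
    (hfin : {t | ¬ ContinuousAt w t}.Finite)
    (hstab : ∀ᵐ t, t ∈ Ioo 0 T → ‖storedGrad A F (w t) - l t‖ ≤ ρ) :
    ∀ᵐ s, s ∈ Ioo (graphParamLeft ρ w 0) (graphParamRight ρ w T) →
      forceDist A F R (graphLoad A F ρ w l) (graphState ρ w) s = 0 := by
  filter_upwards [ae_mem_jumpSegments_or hρ hw hfin,
    ae_norm_storedGrad_graphState_sub_le hF hρ hw hl hstab] with s h1 h2 hs
  refine forceDist_eq_zero hA hF hρ hR ?_
  by_cases h : s ∈ jumpSegments ρ w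
  · exact (norm_storedGrad_sub_graphLoad hρ hw h).le
  · have hc := h1.resolve_left h
    rw [graphLoad, if_neg h]
    exact h2 (graphTime_mem_Ioo hρ hw hs hc) hc

/-- The energy balance in differential form holds almost everywhere along the completed graph: the
parameters off the jumps are covered by countably many intervals on which `w` is continuous. -/
theorem ae_energy_rate_graphLoad (hA : A.IsHermitian) (hF : IsNonlinearity F) (hρ : 0 < ρ)
    (hR : ∀ v, R v = ρ * ‖v‖) (hw : BoundedVariationOn w univ) (hl : BoundedVariationOn l univ)
    (hfin : {t | ¬ ContinuousAt w t}.Finite)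
    (hstab : ∀ᵐ t, t ∈ Ioo 0 T → ‖storedGrad A F (w t) - l t‖ ≤ ρ)
    (henergy : ∀ t₁ t₂, 0 ≤ t₁ → t₁ ≤ t₂ → t₂ ≤ T → ∃ J, HasKurzweilIntegral w l t₁ t₂ J ∧
      energy A F l t₂ (w t₂) + diss R w t₁ t₂ ≤ energy A F l t₁ (w t₁) - J) :
    ∀ᵐ s, s ∈ Ioo (graphParamLeft ρ w 0) (graphParamRight ρ w T) →
      inner ℝ (storedGrad A F (graphState ρ w s)) (deriv (graphState ρ w) s)
        + ρ * ‖deriv (graphState ρ w) s‖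
        - inner ℝ (graphLoad A F ρ w l s) (deriv (graphState ρ w) s) = 0 := by
  have hall : ∀ᵐ s, ∀ q₁ q₂ : ℚ, 0 < (q₁ : ℝ) → q₁ ≤ q₂ → (q₂ : ℝ) < T →
      (∀ t ∈ Icc (q₁ : ℝ) q₂, ContinuousAt w t) →
      s ∈ Ioc (graphParam ρ w q₁) (graphParam ρ w q₂) →
      inner ℝ (storedGrad A F (graphState ρ w s)) (deriv (graphState ρ w) s)
        + ρ * ‖deriv (graphState ρ w) s‖
        - inner ℝ (l (graphTime ρ w s)) (deriv (graphState ρ w) s) = 0 := by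
    refine ae_all_iff.2 fun q₁ => ae_all_iff.2 fun q₂ => ?_
    by_cases hq : 0 < (q₁ : ℝ) ∧ q₁ ≤ q₂ ∧ (q₂ : ℝ) < T ∧
      ∀ t ∈ Icc (q₁ : ℝ) q₂, ContinuousAt w t
    · obtain ⟨h1, h2, h3, h4⟩ := hq
      obtain ⟨J, hJ, hE⟩ := henergy q₁ q₂ h1.le (Rat.cast_le.2 h2) h3.le
      filter_upwards [ae_energy_rate_eq_zero hA hF hρ hR hw hl hstab h1 (Rat.cast_le.2 h2) h3 h4
        hJ hE] with s hs _ _ _ _ hsI using hs hsI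
    · exact Eventually.of_forall fun s h1 h2 h3 h4 => absurd ⟨h1, h2, h3, h4⟩ hq
  filter_upwards [ae_mem_jumpSegments_or hρ hw hfin, hall] with s h1 h2 hs
  by_cases h : s ∈ jumpSegments ρ w
  · exact energy_rate_of_mem_jumpSegments hρ hw h
  have hc := h1.resolve_left h
  have ht := graphTime_mem_Ioo hρ hw hs hc
  have hsb := eq_graphParam_graphTime hρ hw hc
  rw [graphLoad, if_neg h]
  have hU : Ioo 0 T ∩ {t | ¬ ContinuousAt w t}ᶜ ∈ 𝓝 (graphTime ρ w s) :=
    (isOpen_Ioo.inter hfin.isClosed.isOpen_compl).mem_nhds ⟨ht, fun h => h hc⟩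
  obtain ⟨ε, hε, hball⟩ := Metric.mem_nhds_iff.1 hU
  rw [Real.ball_eq_Ioo] at hball
  obtain ⟨q₁, hq1, hq1'⟩ := exists_rat_btwn
    (show graphTime ρ w s - ε < graphTime ρ w s by linarith)
  obtain ⟨q₂, hq2, hq2'⟩ := exists_rat_btwn
    (show graphTime ρ w s < graphTime ρ w s + ε by linarith)
  have hsub : ∀ t ∈ Icc (q₁ : ℝ) q₂, t ∈ Ioo 0 T ∩ {t | ¬ ContinuousAt w t}ᶜ := fun t ht =>
    hball ⟨hq1.trans_le ht.1, ht.2.trans_lt hq2'⟩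
  have h12 : (q₁ : ℝ) ≤ q₂ := (hq1'.trans hq2).le
  refine h2 q₁ q₂ (hsub _ (left_mem_Icc.2 h12)).1.1 (Rat.cast_le.1 h12)
    (hsub _ (right_mem_Icc.2 h12)).1.2 (fun t ht => not_not.1 (hsub t ht).2) ?_
  rw [hsb]
  exact ⟨graphParam_strictMono hρ hw hq1', (graphParam_strictMono hρ hw).monotone hq2.le⟩

theorem notMem_jumpSegments_of_mem_increasingSet (hρ : 0 < ρ) (hw : BoundedVariationOn w univ)
    {S s : ℝ} (hs : s ∈ increasingSet S (graphTime ρ w)) : s ∉ jumpSegments ρ w := by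
  intro h
  obtain ⟨t, α, β, v, -, -, -, hsI, -, -, H⟩ := exists_segment hρ hw h
  obtain ⟨⟨h0, hS⟩, hlt⟩ := hs
  obtain ⟨s₁, h1, h1'⟩ := exists_between (max_lt h0 hsI.1)
  obtain ⟨s₂, h2, h2'⟩ := exists_between (lt_min hS hsI.2)
  have h3 := max_lt_iff.1 h1
  have h4 := lt_min_iff.1 h2'
  have := hlt s₁ ⟨h3.1.le, (h1'.trans hS).le⟩ s₂ ⟨(h0.trans h2).le, h4.1.le⟩ h1' h2
  rw [(H s₁ ⟨h3.2, h1'.trans hsI.2⟩).1, (H s₂ ⟨hsI.1.trans h2, h4.2⟩).1] at this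
  exact lt_irrefl _ this

end AlmostEverywhere

/-! ### The relaxed solution -/

/-- The completed graph of the extended state, with its load, is a relaxed solution. -/
theorem isRelaxedSolution_graph {d : ℕ} {A : Matrix (Fin d) (Fin d) ℝ} {F R : Vec d → ℝ}
    {ρ T : ℝ} {z₀ : Vec d} {l z : ℝ → Vec d} (hA : A.IsHermitian) (hF : IsNonlinearity F)
    (hρ : 0 < ρ) (hR : ∀ v, R v = ρ * ‖v‖) (hT : 0 < T) (hl : BoundedVariationOn l (Icc 0 T))
    (hz : IsLocalSolution A F R T l z)
    (hjumps : {t ∈ Icc 0 T | ¬ ContinuousWithinAt z (Icc 0 T) t}.Finite) :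
    IsRelaxedSolution A F R z₀ T l (graphParamRight ρ (extendState z₀ T z) T)
      (graphTime ρ (extendState z₀ T z)) (graphState ρ (extendState z₀ T z))
      (graphLoad A F ρ (extendState z₀ T z) (extendLoad T l)) := by
  have hw : BoundedVariationOn (extendState z₀ T z) univ := boundedVariationOn_extendState hT hz.bv
  have hl' := boundedVariationOn_extendLoad hT hl
  have hfin := finite_not_continuousAt_extendState (z₀ := z₀) hjumps
  have ha0 := graphParamLeft_extendState_zero (z₀ := z₀) (ρ := ρ) hT hz.bv
  have hcT := graphParamRight_extendState_end (z₀ := z₀) (ρ := ρ) hT hz.bv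
  have hw0 := leftLim_extendState (z₀ := z₀) hT hz.bv (left_mem_Icc.2 hT.le)
  have hzw : EqOn z (extendState z₀ T z) (Icc 0 T) := fun t ht => (extendState_of_mem ht).symm
  have hll : EqOn l (extendLoad T l) (Icc 0 T) := fun t ht => (extendLoad_of_mem ht).symm
  have hb : graphParam ρ (extendState z₀ T z) (-1) = -1 :=
    graphParam_extendState ⟨le_rfl, by norm_num⟩
  have hstab : ∀ᵐ t, t ∈ Ioo 0 T →
      ‖storedGrad A F (extendState z₀ T z t) - extendLoad T l t‖ ≤ ρ := by
    have h := hz.stable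
    rw [ae_restrict_iff' measurableSet_Icc] at h
    filter_upwards [h] with t ht hI
    obtain ⟨xi, hxi, h0⟩ := ht (Ioo_subset_Icc_self hI)
    rw [subdiff_zero_eq_closedBall hρ hR, mem_closedBall_zero_iff] at hxi
    rw [gradient_energy hA hF] at h0
    rw [← hzw (Ioo_subset_Icc_self hI), ← hll (Ioo_subset_Icc_self hI),
      eq_neg_of_add_eq_zero_right h0.symm, norm_neg]
    exact hxi
  have henergy : ∀ t₁ t₂, 0 ≤ t₁ → t₁ ≤ t₂ → t₂ ≤ T →
      ∃ J, HasKurzweilIntegral (extendState z₀ T z) (extendLoad T l) t₁ t₂ J ∧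
        energy A F (extendLoad T l) t₂ (extendState z₀ T z t₂)
            + diss R (extendState z₀ T z) t₁ t₂
          ≤ energy A F (extendLoad T l) t₁ (extendState z₀ T z t₁) - J := by
    intro t₁ t₂ h1 h12 h2
    obtain ⟨J, hJ, hE⟩ := hz.energy_le t₁ t₂ h1 h12 h2
    have hsub : Icc t₁ t₂ ⊆ Icc 0 T := Icc_subset_Icc h1 h2
    have h1m := hsub (left_mem_Icc.2 h12)
    have h2m := hsub (right_mem_Icc.2 h12)
    refine ⟨J, hasKurzweilIntegral_congr (hzw.mono hsub) (hll.mono hsub) hJ, ?_⟩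
    rw [← diss_congr (hzw.mono hsub), ← hzw h1m, ← hzw h2m]
    simpa only [energy, ← hll h1m, ← hll h2m] using hE
  have hdist := ae_forceDist_eq_zero hA hF hρ hR hw hl' hfin hstab
  have hrate := ae_energy_rate_graphLoad hA hF hρ hR hw hl' hfin hstab henergy
  rw [ha0] at hdist hrate
  generalize hwdef : extendState z₀ T z = w at *
  have hS : 0 < graphParamRight ρ w T :=
    calc 0 = graphParamLeft ρ w 0 := ha0.symm
      _ ≤ graphParamRight ρ w 0 := (graphParamLeft_le hρ 0).trans (le_graphParamRight hρ 0)
      _ < graphParamLeft ρ w T := graphParamRight_lt_left hρ hw hT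
      _ ≤ graphParamRight ρ w T := (graphParamLeft_le hρ T).trans (le_graphParamRight hρ T)
  have htimeS : graphTime ρ w (graphParamRight ρ w T) = T :=
    (graphTime_eq_iff hρ hw).2
      ⟨(graphParamLeft_le hρ T).trans (le_graphParamRight hρ T), le_rfl⟩
  have htime0 : graphTime ρ w 0 = 0 := (graphTime_eq_iff hρ hw).2
    ⟨ha0.le, ha0.symm.le.trans ((graphParamLeft_le hρ 0).trans (le_graphParamRight hρ 0))⟩
  have hnorm : ∀ᵐ s, s ∈ Ioo 0 (graphParamRight ρ w T) →
      deriv (graphTime ρ w) s + ρ * ‖deriv (graphState ρ w) s‖ = 1 := by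
    filter_upwards [ae_deriv_graphTime_add hρ hw (show (-1 : ℝ) ≤ T by linarith)] with s hs hI
    exact hs ⟨by rw [hb]; linarith [hI.1], hcT ▸ hI.2.le⟩
  have hlipT := graphTime_lipschitz hρ hw
  have hlip := graphState_lipschitz hρ hw
  refine ⟨deriv (graphTime ρ w), deriv (graphState ρ w), hS, isW1Infty_of_lipschitz hlipT hS.le,
    isW1Infty_of_lipschitz hlip hS.le, boundedVariationOn_graphLoad hF hρ hw hl' hfin _,
    htime0, htimeS, ?_, ?_, ?_, ?_, ?_, ?_⟩
  · rw [← ha0, graphState_left hρ hw, hw0, leftState, if_pos le_rfl]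
  · exact Eventually.of_forall fun s => (graphTime_monotone hρ hw).deriv_nonneg
  · rw [ae_restrict_iff' measurableSet_Ioo]
    filter_upwards [hdist] with s hs hI
    rw [hs hI, mul_zero]
  · rw [ae_restrict_iff' measurableSet_Ioo]
    filter_upwards [hdist, hnorm] with s hs hn hI
    rw [hs hI, hR, mul_zero, add_zero, hn hI]
  · intro s₁ h₁ s₂ h₂
    have hne : ∀ᵐ s : ℝ, s ≠ graphParamRight ρ w T := by simp [ae_iff, measure_singleton]
    have hI : ∀ s, s ∈ uIoc s₁ s₂ → s ≠ graphParamRight ρ w T →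
        s ∈ Ioo 0 (graphParamRight ρ w T) := fun s hs hne =>
      ⟨(le_min h₁.1 h₂.1).trans_lt hs.1, lt_of_le_of_ne (hs.2.trans (max_le h₁.2 h₂.2)) hne⟩
    have hi1 := intervalIntegrable_inner_storedGrad (A := A) hF hlip s₁ s₂
    have hi2 := (intervalIntegrable_deriv_of_lipschitz hlip s₁ s₂).norm.const_mul ρ
    have e1 : ∫ r in s₁..s₂, (R (deriv (graphState ρ w) r) + ‖deriv (graphState ρ w) r‖ *
          forceDist A F R (graphLoad A F ρ w (extendLoad T l)) (graphState ρ w) r) =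
        ∫ r in s₁..s₂, ρ * ‖deriv (graphState ρ w) r‖ := by
      refine intervalIntegral.integral_congr_ae ?_
      filter_upwards [hdist, hne] with s hs hsne hsI
      rw [hs (hI s hsI hsne), hR, mul_zero, add_zero]
    have e2 : ∫ r in s₁..s₂, inner ℝ (graphLoad A F ρ w (extendLoad T l) r)
          (deriv (graphState ρ w) r) =
        ∫ r in s₁..s₂, (inner ℝ (storedGrad A F (graphState ρ w r)) (deriv (graphState ρ w) r)
          + ρ * ‖deriv (graphState ρ w) r‖) := by
      refine intervalIntegral.integral_congr_ae ?_
      filter_upwards [hrate, hne] with s hs hsne hsI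
      linarith [hs (hI s hsI hsne)]
    rw [e1, e2, intervalIntegral.integral_add hi1 hi2, integral_inner_storedGrad hA hF hlip]
    ring
  · refine Eventually.of_forall fun s hs => ?_
    rw [graphLoad, if_neg (notMem_jumpSegments_of_mem_increasingSet hρ hw hs)]
    refine extendLoad_of_mem ⟨?_, ?_⟩
    · rw [← htime0]; exact graphTime_monotone hρ hw hs.1.1.le
    · conv_rhs => rw [← htimeS]
      exact graphTime_monotone hρ hw hs.1.2.le

end RIS
end

theorem theorem4p3 {d : ℕ} (A : Matrix (Fin d) (Fin d) ℝ) (hA : A.PosDef)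
    (F : RIS.Vec d → ℝ) (hF : RIS.IsNonlinearity F)
    (R : RIS.Vec d → ℝ) (hR : RIS.IsDissipation R)
    (T : ℝ) (hT : 0 < T)
    (z₀ : RIS.Vec d)
    (hz₀ : ∃ l₀ : RIS.Vec d, -gradient (RIS.storedEnergy A F) z₀ + l₀ ∈ RIS.subdiff R 0)
    (hsymm : ∀ z₁ z₂ : RIS.Vec d, R z₁ = R z₂ ↔ ‖z₁‖ = ‖z₂‖)
    (l : ℝ → RIS.Vec d) (hl : BoundedVariationOn l (Set.Icc 0 T))
    (z : ℝ → RIS.Vec d) (hz : RIS.IsLocalSolution A F R T l z)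
    (hjumps : {t ∈ Set.Icc 0 T | ¬ ContinuousWithinAt z (Set.Icc 0 T) t}.Finite) :
    ∃ (S : ℝ) (that : ℝ → ℝ) (zhat lhat : ℝ → RIS.Vec d),
      RIS.IsRelaxedSolution A F R z₀ T l S that zhat lhat ∧
      z ∈ RIS.projections T S that zhat ∧
      ∀ t ∈ Set.Icc 0 T, ∃ a b c : ℝ, a ≤ b ∧ b ≤ c ∧
        {s ∈ Set.Icc 0 S | that s = t} = Set.Icc a c ∧
        RIS.IsLinearJump A F R zhat lhat a b (RIS.leftState z₀ z t) (z t) ∧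
        RIS.IsLinearJump A F R zhat lhat b c (z t) (RIS.rightState T z t) := by
  open RIS in
  obtain ⟨ρ, hρ, hRρ⟩ := hR.exists_eq_mul_norm hsymm
  have hw : BoundedVariationOn (extendState z₀ T z) univ := boundedVariationOn_extendState hT hz.bv
  have ha0 := graphParamLeft_extendState_zero (z₀ := z₀) (ρ := ρ) hT hz.bv
  have hIcc : ∀ t ∈ Icc 0 T, Icc (graphParamLeft ρ (extendState z₀ T z) t)
      (graphParamRight ρ (extendState z₀ T z) t) ⊆
        Icc 0 (graphParamRight ρ (extendState z₀ T z) T) := fun t ht =>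
    Icc_subset_Icc (ha0.symm.le.trans (graphParamLeft_monotone hρ hw ht.1))
      (graphParamRight_monotone hρ hw ht.2)
  refine ⟨_, _, _, _, isRelaxedSolution_graph hA.isHermitian hF hρ hRρ hT hl hz hjumps,
    fun t ht => ⟨_, hIcc t ht ⟨graphParamLeft_le (w := extendState z₀ T z) hρ t, le_graphParamRight hρ t⟩,
      (graphTime_graphParam hρ hw t).symm, ?_⟩, fun t ht => ⟨_, _, _,
      graphParamLeft_le (w := extendState z₀ T z) hρ t, le_graphParamRight hρ t, ?_, ?_, ?_⟩⟩
  · rw [graphState_graphParam hρ hw, extendState_of_mem ht]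
  · ext s
    exact ⟨fun hs => (graphTime_eq_iff hρ hw).1 hs.2,
      fun hs => ⟨hIcc t ht hs, (graphTime_eq_iff hρ hw).2 hs⟩⟩
  · rw [← leftLim_extendState hT hz.bv ht, ← extendState_of_mem (z₀ := z₀) (z := z) ht]
    exact isLinearJump_of_segment hρ hRρ hw (graphParam_sub_left t) (graphState_left hρ hw t)
      (graphState_graphParam hρ hw t) (fun s hs => graphState_of_mem_left hρ hw hs)
      (left_subset_jumpSegments t)
  · rw [← rightLim_extendState (z₀ := z₀) hT hz.bv ht,
      ← extendState_of_mem (z₀ := z₀) (z := z) ht]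
    exact isLinearJump_of_segment hρ hRρ hw (graphParam_right_sub t)
      (graphState_graphParam hρ hw t) (graphState_right hρ hw t)
      (fun s hs => graphState_of_mem_right hρ hw hs) (right_subset_jumpSegments t)
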